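/- **Setting.** Fix $r>0$, $\lambda>0$, $z$, $s$ with $g:=\lambda z>s>0$, and $\bar c>(\tfrac{\lambda}{r}+1)(g-s)$. Agents arrive sequentially with i.i.d. private reporting costs $c\in[0,\bar c]$ drawn from a distribution $H$ whose density $h$ is smooth and positive on $(0,\bar c)$, with positive (finite) limits at $0^+$ and $\bar c^-$, and such that $x\mapsto x+H(x)/h(x)$ has positive derivative on $(0,\bar c)$. Write $\mathbb E$ for expectation in $c\sim H$. A safe product gives flow utility $s$; a risky product gives, in the good state, a lump sum $z$ at rate $\lambda$, and nothing in the bad state; $\alpha\in(0,1)$ is the common belief that the state is good. A mechanism consists of measurable $p,q,t$: an agent declaring cost $\tilde c$ at belief $\alpha$ gets the risky product with probability $p(\alpha,\tilde c)\in[0,1]$, must then report his utility with probability $q(\alpha,\tilde c)\in[0,1]$, and pays $t(\alpha,\tilde c)$; with true cost $c$ his flow utility is $$U(c,\tilde c,\alpha)=-t(\alpha,\tilde c)+p(\alpha,\tilde c)\,[\alpha z\lambda-q(\alpha,\tilde c)c]+(1-p(\alpha,\tilde c))s .$$ The mechanism is incentive compatible if $c\in\arg\max_{\tilde c\in[0,\bar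 c]}U(c,\tilde c,\alpha)$ for all $\alpha\in(0,1)$ and $c\in[0,\bar c]$. Let $x(\alpha)=\mathbb E[p(\alpha,c)q(\alpha,c)]$. From an initial belief $\alpha_0\in(0,1)$, a (continuous) no-news belief path generated by the mechanism is a solution of $$\alpha_\tau=\frac{\alpha_0e^{-\lambda X_\tau}}{S_\tau},\qquad X_\tau=\int_0^\tau x(\alpha_u)\,du,\qquad S_\tau=\alpha_0e^{-\lambda X_\tau}+1-\alpha_0\qquad(\tau\ge 0),$$ and its welfare along such a path is the expected discounted social surplus (under truthful declaration; continuation value $\lambda z/r$ once good news is reported) $$\int_0^\infty e^{-r\tau}S_\tau\Big(\mathbb E\big[p\lambda z\alpha_\tau-pqc+(1-p)s\big]+\lambda\alpha_\tau x(\alpha_\tau)\tfrac{\lambda z}{r}\Big)d\tau,$$ where $p,q$ are evaluated at $(\alpha_\tau,c)$. Let $W(\alpha_0)$ be the supremum of welfare over all mechanisms and their belief paths from $\alpha_0$. A mechanism is optimal if from every $\alpha_0\in(0,1)$ it generates a belief path, and every belief path that it generates from $\alpha_0$ attains the maximum of welfare. Put $$B(\alpha)=\frac{\alpha\lambda^2z}{r}+(\alpha^2-\alpha)\lambda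 W'(\alpha)-\lambda\alpha W(\alpha),\qquad C_1(\alpha)=B(\alpha)+\lambda z\alpha-s,\qquad C_2(\alpha)=B(\alpha).$$ **Proposition.** There exist an incentive-compatible optimal mechanism $(p,q,t)$ and cutoffs $0<\bar\alpha_{SA}^{PC}<\bar\alpha_{PC}^{FC}<\bar\alpha_{FC}^{NB}<1$ such that $W$ is differentiable on $(0,1)$ and satisfies there $$[r+\lambda\alpha\,\mathbb E(pq)]W=\lambda\alpha z\,\mathbb E(p)+[1-\mathbb E(p)]s-\mathbb E(pqc)+\tfrac{\lambda^2z\alpha}{r}\mathbb E(pq)+(\alpha^2-\alpha)\lambda W'\,\mathbb E(pq),$$ and, for all $c\in[0,\bar c]$: * if $0<\alpha<\bar\alpha_{SA}^{PC}$, then $p=q=0$ (Safe Arm); * if $\bar\alpha_{SA}^{PC}<\alpha<\bar\alpha_{PC}^{FC}$, then $0<C_1(\alpha)<\bar c$, $q=1$, and $p=1$ if $c<C_1(\alpha)$, $p=0$ otherwise (Partial Coverage); * if $\bar\alpha_{PC}^{FC}<\alpha<\bar\alpha_{FC}^{NB}$, then $0<C_2(\alpha)<\bar c$, $p=1$, and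 $q=1$ if $c<C_2(\alpha)$, $q=0$ otherwise (Full Coverage); * if $\bar\alpha_{FC}^{NB}<\alpha<1$, then $p=1$ and $q=0$ (Non Bonus). -/

import Mathlib

open Set Filter Topology MeasureTheory

noncomputable section

/-- Primitives of the exponential-bandit market with costly reporting, with the standing
assumptions.  `lam` is the arrival rate of the lump sum `z` in the good state, `s` the flow utility
of the safe product, `r` the discount rate, and `h` the density of the reporting cost on
`[0, cbar]` (only its values on the open interval matter). -/
structure Market where
  r : ℝ
  lam : ℝ
  z : ℝ
  s : ℝ
  cbar : ℝ
  h : ℝ → ℝ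
  r_pos : 0 < r
  lam_pos : 0 < lam
  s_pos : 0 < s
  s_lt : s < lam * z
  h_smooth : ContDiffOn ℝ (⊤ : ℕ∞) h (Ioo 0 cbar)
  h_pos : ∀ c ∈ Ioo 0 cbar, 0 < h c
  h_total : ∫ c in (0 : ℝ)..cbar, h c = 1
  h_left : ∃ l : ℝ, 0 < l ∧ Tendsto h (𝓝[>] 0) (𝓝 l)
  h_right : ∃ l : ℝ, 0 < l ∧ Tendsto h (𝓝[<] cbar) (𝓝 l)
  /-- The virtual value `x + H x / h x` has positive derivative
  (it is smooth since `h` is smooth and positive). -/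
  virtual_deriv_pos : ∀ x ∈ Ioo 0 cbar,
    0 < deriv (fun y : ℝ => y + (∫ c in (0 : ℝ)..y, h c) / h y) x
  cbar_large : (lam / r + 1) * (lam * z - s) < cbar

namespace Market

/-- Expectation with respect to the reporting cost. -/
def expect (M : Market) (f : ℝ → ℝ) : ℝ :=
  ∫ c in (0 : ℝ)..M.cbar, f c * M.h c

/-- A direct mechanism of the planner.  At belief `α` and reported cost `c`, the risky product is
allocated with probability `p α c`; given this allocation, the agent is obliged to report his
utility with probability `q α c`; and he pays the transfer `t α c`. -/
structure Mechanism (M : Market) where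
  p : ℝ → ℝ → ℝ
  q : ℝ → ℝ → ℝ
  t : ℝ → ℝ → ℝ
  p_measurable : Measurable (Function.uncurry p)
  q_measurable : Measurable (Function.uncurry q)
  t_measurable : Measurable (Function.uncurry t)
  p_mem : ∀ α ∈ Ioo (0 : ℝ) 1, ∀ c ∈ Icc 0 M.cbar, p α c ∈ Icc (0 : ℝ) 1
  q_mem : ∀ α ∈ Ioo (0 : ℝ) 1, ∀ c ∈ Icc 0 M.cbar, q α c ∈ Icc (0 : ℝ) 1

variable {M : Market}

namespace Mechanism

/-- Flow utility of an agent with true cost `c` who declares the cost `c'` at belief `α`. -/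
def agentUtility (m : M.Mechanism) (c c' α : ℝ) : ℝ :=
  -m.t α c' + m.p α c' * (α * M.z * M.lam - m.q α c' * c) + (1 - m.p α c') * M.s

/-- Truthful declaration of the cost is optimal for every agent, at every belief. -/
def IncentiveCompatible (m : M.Mechanism) : Prop :=
  ∀ α ∈ Ioo (0 : ℝ) 1, ∀ c ∈ Icc 0 M.cbar, ∀ c' ∈ Icc 0 M.cbar,
    m.agentUtility c c' α ≤ m.agentUtility c c α

/-- Probability that the current agent consumes the risky product and reports, `E(pq)`. -/
def reportProb (m : M.Mechanism) (α : ℝ) : ℝ :=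
  M.expect fun c => m.p α c * m.q α c

/-- Expected flow of social surplus at belief `α` (transfers cancel). -/
def flowSurplus (m : M.Mechanism) (α : ℝ) : ℝ :=
  M.expect fun c =>
    m.p α c * (M.lam * M.z * α) - m.p α c * m.q α c * c + (1 - m.p α c) * M.s

/-- Amount of reported experimentation up to time `τ`, along the belief path `a`. -/
def experience (m : M.Mechanism) (a : ℝ → ℝ) (τ : ℝ) : ℝ :=
  ∫ u in (0 : ℝ)..τ, m.reportProb (a u)

/-- Probability, at initial belief `α₀`, that no good news is reported up to time `τ`:
in the good state reported good news arrives at rate `lam * reportProb`, in the bad state never. -/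
def noNewsProb (m : M.Mechanism) (α₀ : ℝ) (a : ℝ → ℝ) (τ : ℝ) : ℝ :=
  α₀ * Real.exp (-(M.lam * m.experience a τ)) + (1 - α₀)

/-- `a` is the path of the common belief, as long as no good news is reported, that starts at `α₀`
and is generated through Bayes' rule by the mechanism `m`. -/
structure IsBeliefPath (m : M.Mechanism) (α₀ : ℝ) (a : ℝ → ℝ) : Prop where
  continuousOn : ContinuousOn a (Ici 0)
  bayes : ∀ τ, 0 ≤ τ →
    a τ = α₀ * Real.exp (-(M.lam * m.experience a τ)) / m.noNewsProb α₀ a τ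

/-- Expected discounted social surplus of the mechanism `m` from the initial belief `α₀`, along the
no-news belief path `a`.  Reported good news arrives at rate `lam * α * reportProb`; the belief then
jumps to `1`, where the continuation value is `lam * z / r`. -/
def welfare (m : M.Mechanism) (α₀ : ℝ) (a : ℝ → ℝ) : ℝ :=
  ∫ τ in Ioi (0 : ℝ), Real.exp (-(M.r * τ)) * m.noNewsProb α₀ a τ *
    (m.flowSurplus (a τ) + M.lam * a τ * m.reportProb (a τ) * (M.lam * M.z / M.r))

end Mechanism

/-- The levels of welfare that mechanisms can generate from the initial belief `α₀`. -/
def attainable (M : Market) (α₀ : ℝ) : Set ℝ :=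
  {v | ∃ (m : M.Mechanism) (a : ℝ → ℝ), m.IsBeliefPath α₀ a ∧ v = m.welfare α₀ a}

/-- A mechanism is optimal if from every initial belief it generates a belief path, and any path it
generates yields the greatest welfare among all mechanisms. -/
def Mechanism.IsOptimal (m : M.Mechanism) : Prop :=
  ∀ α₀ ∈ Ioo (0 : ℝ) 1, (∃ a, m.IsBeliefPath α₀ a) ∧
    ∀ a, m.IsBeliefPath α₀ a → IsGreatest (M.attainable α₀) (m.welfare α₀ a)

/-- The planner's value function. -/
def W (M : Market) (α : ℝ) : ℝ := sSup (M.attainable α)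

/-- The net social value of one more report. -/
def B (M : Market) (α : ℝ) : ℝ :=
  α * M.lam ^ 2 * M.z / M.r + (α ^ 2 - α) * M.lam * deriv M.W α - M.lam * α * M.W α

/-- The cost cutoff under Partial Coverage. -/
def C₁ (M : Market) (α : ℝ) : ℝ := M.B α + M.lam * M.z * α - M.s

/-- The cost cutoff under Full Coverage. -/
def C₂ (M : Market) (α : ℝ) : ℝ := M.B α

end Market

/-!
In log-odds, Bayes' rule translates the belief, at the speed at which agents report. A mechanism
whose reporting probability is continuous in the belief thus generates a belief path by Peano's
theorem.

Let `b` be the net value of a report at belief `α`. Writing `(x)⁺ = max x 0`, the best flow at `α`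
is `max s (g α) + E (b - loss - c)⁺`, where `loss` is the flow utility given up by choosing the
risky product. Inverting the increasing function `b ↦ E (b - c)⁺` turns the Bellman equation into
an explicit ordinary differential equation, solved from the belief at which the first report is
just worth its cost. Comparison arguments locate the cutoffs: reports stop paying before belief `1`
because near `0` the inverse is at least of the order of a square root, so that the gain over the
risky product without reports reaches `0`.

For the verification, the value weighted by the probability of no news is a `C¹` function of the
amount of reported experimentation, which is Lipschitz in time. Hence the discounted weighted value
is absolutely continuous along every belief path. It falls at least as fast as welfare accrues, and
exactly as fast under the mechanism that collects the reports worth their cost.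
-/

noncomputable section

/-- The average of `f t` over `[x, x + δ]`, written so that it makes sense at `δ = 0` too: a
regularization of a continuous field `f` that is Lipschitz in `x` as soon as `δ > 0`. -/
def intervalAverage (f : ℝ → ℝ → ℝ) (δ t x : ℝ) : ℝ :=
  ∫ σ in (0 : ℝ)..1, f t (x + δ * σ)

section Peano

open scoped NNReal

variable {f : ℝ → ℝ → ℝ} {L : ℝ≥0}

lemma continuous_intervalAverage (hf : Continuous ↿f) : Continuous ↿(intervalAverage f) :=
  intervalIntegral.continuous_parametric_intervalIntegral_of_continuous'
    (f := fun (p : ℝ × ℝ × ℝ) σ => f p.2.1 (p.2.2 + p.1 * σ))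
    (hf.comp (by fun_prop :
      Continuous fun q : (ℝ × ℝ × ℝ) × ℝ => (q.1.2.1, q.1.2.2 + q.1.1 * q.2))) 0 1

lemma abs_intervalAverage_le (hL : ∀ t x, |f t x| ≤ L) (δ t x : ℝ) :
    |intervalAverage f δ t x| ≤ L := by
  simpa [intervalAverage] using intervalIntegral.norm_integral_le_of_norm_le_const (a := 0) (b := 1)
    (f := fun σ => f t (x + δ * σ)) fun σ _ => hL t (x + δ * σ)

lemma lipschitzWith_intervalAverage (hf : Continuous ↿f) (hL : ∀ t x, |f t x| ≤ L) {δ : ℝ≥0}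
    (hδ : 0 < δ) (t : ℝ) : LipschitzWith (2 * L / δ) (intervalAverage f δ t) := by
  have hft : Continuous (f t) := hf.comp (by fun_prop : Continuous fun x : ℝ => (t, x))
  have hint : ∀ a b : ℝ, IntervalIntegrable (f t) volume a b := hft.intervalIntegrable
  have hbound : ∀ a b : ℝ, |∫ y in a..b, f t y| ≤ L * |b - a| := fun a b =>
    intervalIntegral.norm_integral_le_of_norm_le_const (f := f t) fun y _ => hL t y
  have haverage : ∀ x, intervalAverage f δ t x = (δ : ℝ)⁻¹ * ∫ y in x..x + δ, f t y := fun x => by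
    simpa [intervalAverage] using intervalIntegral.integral_comp_add_mul (a := 0) (b := 1) (f t)
      (NNReal.coe_ne_zero.2 hδ.ne') x
  refine LipschitzWith.of_dist_le_mul fun x y => ?_
  rw [Real.dist_eq, Real.dist_eq, haverage, haverage, ← mul_sub, abs_mul, abs_inv, NNReal.abs_eq,
    intervalIntegral.integral_interval_sub_interval_comm (hint _ _) (hint _ _) (hint _ _)]
  calc (δ : ℝ)⁻¹ * |(∫ u in x..y, f t u) - ∫ u in x + δ..y + δ, f t u|
      ≤ (δ : ℝ)⁻¹ * (L * |y - x| + L * |y + δ - (x + δ)|) := by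
        gcongr
        exact (abs_sub _ _).trans (add_le_add (hbound _ _) (hbound _ _))
    _ = ↑(2 * L / δ) * |x - y| := by
        rw [add_sub_add_right_eq_sub, abs_sub_comm y x]
        push_cast
        ring

lemma exists_hasDerivAt_of_lipschitzWith {K : ℝ≥0} (hf : Continuous ↿f)
    (hL : ∀ t x, |f t x| ≤ L) (hK : ∀ t, LipschitzWith K (f t)) (t₀ x₀ : ℝ) (T : ℝ≥0) :
    ∃ y : C(ℝ, ℝ), LipschitzWith L y ∧ y t₀ = x₀ ∧
      ∀ t ∈ Ioo (t₀ - T) (t₀ + T), HasDerivAt y (f t (y t)) t := by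
  have hT : t₀ - T ≤ t₀ + T := by linarith [T.coe_nonneg]
  have ht₀ : t₀ ∈ Icc (t₀ - T) (t₀ + T) := ⟨by simp, by simp⟩
  have hpl : IsPicardLindelof f (tmin := t₀ - T) (tmax := t₀ + T) ⟨t₀, ht₀⟩ x₀ (L * T) 0 L K :=
    { lipschitzOnWith := fun t _ => (hK t).lipschitzOnWith
      continuousOn := fun x _ =>
        (hf.comp (by fun_prop : Continuous fun t : ℝ => (t, x))).continuousOn
      norm_le := fun t _ x _ => hL t x
      mul_max_le := by simp }
  obtain ⟨y, hy₀, hy⟩ := hpl.exists_eq_forall_mem_Icc_hasDerivWithinAt₀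
  have hlip : LipschitzOnWith L y (Icc (t₀ - T) (t₀ + T)) :=
    (convex_Icc _ _).lipschitzOnWith_of_nnnorm_hasDerivWithin_le hy fun t _ => hL t (y t)
  have hext : LipschitzWith L fun t => y (projIcc _ _ hT t) := by
    simpa [Function.comp_def] using hlip.to_restrict.comp (LipschitzWith.projIcc hT)
  have heq : ∀ t ∈ Icc (t₀ - T) (t₀ + T), y (projIcc _ _ hT t) = y t := fun t ht => by
    rw [projIcc_of_mem hT ht]
  refine ⟨⟨_, hext.continuous⟩, hext, (heq t₀ ht₀).trans hy₀, fun t ht => ?_⟩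
  have hnhds : Icc (t₀ - T) (t₀ + T) ∈ 𝓝 t := Icc_mem_nhds ht.1 ht.2
  simp only [ContinuousMap.coe_mk]
  rw [heq t (Ioo_subset_Icc_self ht)]
  exact ((hy t (Ioo_subset_Icc_self ht)).hasDerivAt hnhds).congr_of_eventuallyEq
    (eventually_of_mem hnhds heq)

lemma isCompact_setOf_lipschitzWith (L : ℝ≥0) (t₀ x₀ : ℝ) :
    IsCompact {y : C(ℝ, ℝ) | LipschitzWith L y ∧ y t₀ = x₀} := by
  refine ArzelaAscoli.isCompact_of_equicontinuous _ ?_ ?_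
  · have hclosed : IsClosed {y : ℝ → ℝ | LipschitzWith L y ∧ y t₀ = x₀} := by
      simp only [lipschitzWith_iff_dist_le_mul, ofPred_and, ofPred_forall]
      exact (isClosed_iInter fun s => isClosed_iInter fun t => isClosed_le (by fun_prop)
        (by fun_prop)).inter (isClosed_eq (by fun_prop) (by fun_prop))
    refine (isCompact_univ_pi fun t => isCompact_Icc (a := x₀ - L * |t - t₀|)
      (b := x₀ + L * |t - t₀|)).of_isClosed_subset (?_ : IsClosed _) ?_
    · convert hclosed
      ext y
      exact ⟨by rintro ⟨y, hy, rfl⟩; exact hy, fun hy => ⟨⟨y, hy.1.continuous⟩, hy, rfl⟩⟩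
    · rintro _ ⟨y, ⟨hy, rfl⟩, rfl⟩ t -
      have := abs_le.1 (hy.dist_le_mul t t₀)
      constructor <;> simp only [ContinuousMap.toFun_eq_coe] <;> rw [Real.dist_eq] at this <;>
        linarith
  · exact (LipschitzWith.uniformEquicontinuous _ L fun y => y.2.1).equicontinuous

/-- **Peano's theorem**: averaging the field over short intervals makes it Lipschitz, and the
Picard–Lindelöf solutions of the averaged equations accumulate by Arzelà–Ascoli. -/
theorem exists_hasDerivAt_of_continuous_of_bounded (hf : Continuous ↿f)
    (hL : ∀ t x, |f t x| ≤ L) (t₀ x₀ : ℝ) :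
    ∃ y : ℝ → ℝ, y t₀ = x₀ ∧ ∀ t, HasDerivAt y (f t (y t)) t := by
  have hF := continuous_intervalAverage hf
  have happrox : ∀ n : ℕ, ∃ y : C(ℝ, ℝ), LipschitzWith L y ∧ y t₀ = x₀ ∧
      ∀ t ∈ Ioo (t₀ - n) (t₀ + n), HasDerivAt y (intervalAverage f (1 / (n + 1)) t (y t)) t :=
    fun n => by
      have hδ : (0 : ℝ≥0) < 1 / (n + 1) := by positivity
      simpa using exists_hasDerivAt_of_lipschitzWith
        (hF.comp (by fun_prop : Continuous fun p : ℝ × ℝ => (((1 / (n + 1) : ℝ≥0) : ℝ), p)))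
        (abs_intervalAverage_le hL _) (lipschitzWith_intervalAverage hf hL hδ) t₀ x₀ n
  choose Y hlip hinit hderiv using happrox
  obtain ⟨y, ⟨-, hy₀⟩, hlim⟩ := (isCompact_setOf_lipschitzWith L t₀ x₀).ultrafilter_le_nhds
    (Ultrafilter.map Y (hyperfilter ℕ))
    (le_principal_iff.2 (mem_map.2 (univ_mem' fun n => ⟨hlip n, hinit n⟩)))
  let field : ℝ × C(ℝ, ℝ) → C(ℝ, ℝ) := fun p =>
    ⟨fun t => intervalAverage f p.1 t (p.2 t), hF.comp (by fun_prop :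
      Continuous fun t => (p.1, t, p.2 t))⟩
  have hfield : Continuous field := ContinuousMap.continuous_of_continuous_uncurry _
    (hF.comp (by fun_prop :
      Continuous fun q : (ℝ × C(ℝ, ℝ)) × ℝ => (q.1.1, q.2, q.1.2 q.2)))
  have hY : Tendsto Y (hyperfilter ℕ) (𝓝 y) := hlim
  have hδ : Tendsto (fun n : ℕ => 1 / ((n : ℝ) + 1)) (hyperfilter ℕ) (𝓝 0) :=
    tendsto_one_div_add_atTop_nhds_zero_nat.mono_left Nat.hyperfilter_le_atTop
  have hfieldY := (hfield.tendsto (0, y)).comp (hδ.prodMk_nhds hY)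
  refine ⟨y, hy₀, fun t => ?_⟩
  obtain ⟨T, hT⟩ := exists_nat_gt |t - t₀|
  have hderiv_t : HasDerivAt y (field (0, y) t) t := by
    refine hasDerivAt_of_tendstoLocallyUniformlyOn (s := Ioo (t₀ - T) (t₀ + T)) isOpen_Ioo
      (ContinuousMap.tendsto_iff_tendstoLocallyUniformly.1 hfieldY).tendstoLocallyUniformlyOn
      ?_ (fun u _ => ((continuous_eval_const u).tendsto y).comp hY) ?_
    · filter_upwards [Nat.hyperfilter_le_atTop (Ici_mem_atTop T)] with n hn u hu
      have hTn : (T : ℝ) ≤ n := by exact_mod_cast hn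
      exact hderiv n u ⟨by linarith [hu.1], by linarith [hu.2]⟩
    · constructor <;> linarith [(abs_lt.1 hT).1, (abs_lt.1 hT).2]
  simpa [field, intervalAverage] using hderiv_t

end Peano

section Barrier

variable {f f' : ℝ → ℝ} {a b : ℝ}

lemma exists_last_nonneg (hab : a ≤ b) (hf : ContinuousOn f (Icc a b)) (ha : 0 ≤ f a)
    (hb : f b < 0) : ∃ y ∈ Ico a b, 0 ≤ f y ∧ ∀ t ∈ Ioc y b, f t < 0 := by
  have hclosed : IsClosed (Icc a b ∩ f ⁻¹' Ici 0) :=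
    hf.preimage_isClosed_of_isClosed isClosed_Icc isClosed_Ici
  obtain ⟨y, ⟨hy, hfy⟩, hmax⟩ := (isCompact_Icc.of_isClosed_subset hclosed
    inter_subset_left).exists_isGreatest ⟨a, ⟨le_rfl, hab⟩, ha⟩
  have hyb : y ≠ b := fun h => hb.not_ge (h ▸ hfy)
  refine ⟨y, ⟨hy.1, hy.2.lt_of_ne hyb⟩, hfy, fun t ht => ?_⟩
  by_contra! hft
  exact ht.1.not_ge (hmax ⟨⟨hy.1.trans ht.1.le, ht.2⟩, hft⟩)

lemma nonneg_of_hasDerivAt_nonneg_of_neg (hab : a ≤ b)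
    (hf : ∀ t ∈ Icc a b, HasDerivAt f (f' t) t) (ha : 0 ≤ f a)
    (hf' : ∀ t ∈ Ioo a b, f t < 0 → 0 ≤ f' t) : 0 ≤ f b := by
  by_contra! hb
  obtain ⟨y, hy, hfy, hneg⟩ := exists_last_nonneg hab (HasDerivAt.continuousOn hf) ha hb
  have hsub : Icc y b ⊆ Icc a b := Icc_subset_Icc_left hy.1
  have hmono : MonotoneOn f (Icc y b) := by
    refine monotoneOn_of_hasDerivWithinAt_nonneg (f' := f') (convex_Icc y b)
      ((HasDerivAt.continuousOn hf).mono hsub) (fun t ht => ?_) fun t ht => ?_ <;>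
      rw [interior_Icc] at ht
    · exact (hf t (hsub (Ioo_subset_Icc_self ht))).hasDerivWithinAt
    · exact hf' t ⟨hy.1.trans_lt ht.1, ht.2⟩ (hneg t ⟨ht.1, ht.2.le⟩)
  exact hb.not_ge (hfy.trans (hmono ⟨le_rfl, hy.2.le⟩ ⟨hy.2.le, le_rfl⟩ hy.2.le))

/-- The square root decreases at least at the rate `κ / (2 (b - t))`, whose integral diverges at
`b`. -/
lemma exists_nonpos_of_hasDerivAt_le_neg_sqrt_div {κ : ℝ} (hab : a < b)
    (hκ : 0 < κ) (hf : ∀ t ∈ Ico a b, HasDerivAt f (f' t) t)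
    (hf' : ∀ t ∈ Ico a b, 0 < f t → f' t ≤ -(κ * √(f t) / (b - t))) :
    ∃ t ∈ Ico a b, f t ≤ 0 := by
  by_contra! hpos
  have hderiv : ∀ t ∈ Ico a b, HasDerivAt (fun t => 2 * √(f t) - κ * Real.log (b - t))
      (2 * (f' t / (2 * √(f t))) - κ * (-1 / (b - t))) t := fun t ht =>
    (((hf t ht).sqrt (hpos t ht).ne').const_mul 2).sub
      ((((hasDerivAt_id t).const_sub b).log (sub_pos.2 ht.2).ne').const_mul κ)
  have hanti : AntitoneOn (fun t => 2 * √(f t) - κ * Real.log (b - t)) (Ico a b) := by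
    refine antitoneOn_of_hasDerivWithinAt_nonpos (convex_Ico a b)
      (HasDerivAt.continuousOn hderiv)
      (fun t ht => (hderiv t (interior_subset ht)).hasDerivWithinAt) fun t ht => ?_
    have ht' := interior_subset ht
    have hsqrt : 0 < √(f t) := Real.sqrt_pos.2 (hpos t ht')
    have hquot : f' t / √(f t) ≤ κ * (-1 / (b - t)) := by
      rw [div_le_iff₀ hsqrt]
      exact (hf' t ht' (hpos t ht')).trans_eq (by ring)
    exact sub_nonpos.2 <|
      (by field_simp : 2 * (f' t / (2 * √(f t))) = f' t / √(f t)).trans_le hquot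
  set N := 2 * √(f a) / κ
  have hNnonneg : 0 ≤ N := by positivity
  have hba : 0 < b - a := sub_pos.2 hab
  have ht : b - (b - a) * Real.exp (-N) ∈ Ico a b := by
    have hexp : Real.exp (-N) ≤ 1 := Real.exp_le_one_iff.2 (neg_nonpos.2 hNnonneg)
    constructor <;> nlinarith [Real.exp_pos (-N)]
  have hle := hanti (left_mem_Ico.2 hab) ht ht.1
  simp only [sub_sub_cancel, Real.log_mul hba.ne' (Real.exp_pos _).ne', Real.log_exp] at hle
  have hκN : κ * N = 2 * √(f a) := mul_div_cancel₀ _ hκ.ne'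
  linarith [Real.sqrt_pos.2 (hpos _ ht)]

end Barrier

/-- The expected payoff `E (b - c)⁺` of posting the price `b` to a cost `c` of law `μ`. -/
def expectedExcess (μ : Measure ℝ) (b : ℝ) : ℝ :=
  ∫ c, max (b - c) 0 ∂μ

section ExpectedExcess

open scoped NNReal

variable {μ : Measure ℝ}

lemma expectedExcess_of_nonpos (hμ : ∀ᵐ c ∂μ, 0 ≤ c) {b : ℝ} (hb : b ≤ 0) :
    expectedExcess μ b = 0 :=
  integral_eq_zero_of_ae (hμ.mono fun _ hc => max_eq_right (by linarith))

lemma integral_indicator_Iio_const (b k : ℝ) :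
    ∫ c, (Iio b).indicator (fun _ => k) c ∂μ = μ.real (Iio b) * k := by
  rw [integral_indicator measurableSet_Iio, setIntegral_const, smul_eq_mul]

variable [IsFiniteMeasure μ]

lemma lipschitzWith_real_Iio {K : ℝ≥0} (hμ : μ ≤ K • volume) :
    LipschitzWith K fun b => μ.real (Iio b) := by
  refine LipschitzWith.of_le_add_mul K fun b b' => ?_
  have hIco : μ.real (Ico b' b) ≤ K * dist b b' := by
    refine (ENNReal.toReal_mono (ENNReal.mul_ne_top ENNReal.coe_ne_top measure_Ico_lt_top.ne)
      (hμ (Ico b' b))).trans ?_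
    rw [ENNReal.toReal_mul, ENNReal.coe_toReal, Real.volume_Ico, Real.dist_eq,
      ENNReal.toReal_ofReal']
    gcongr
    exact max_le (le_abs_self _) (abs_nonneg _)
  calc μ.real (Iio b) ≤ μ.real (Iio b' ∪ Ico b' b) :=
        measureReal_mono fun c hc => (lt_or_ge c b').imp id fun h => ⟨h, hc⟩
    _ ≤ μ.real (Iio b') + μ.real (Ico b' b) := measureReal_union_le _ _
    _ ≤ μ.real (Iio b') + K * dist b b' := by gcongr

lemma integrable_max_sub_zero (hμ : Integrable id μ) (b : ℝ) :
    Integrable (fun c => max (b - c) 0) μ :=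
  ((integrable_const b).sub hμ).pos_part

lemma real_Iio_mul_sub_le (hμ : Integrable id μ) (b b' : ℝ) :
    μ.real (Iio b) * (b' - b) ≤ expectedExcess μ b' - expectedExcess μ b := by
  rw [expectedExcess, expectedExcess, ← integral_sub (integrable_max_sub_zero hμ b')
    (integrable_max_sub_zero hμ b), ← integral_indicator_Iio_const]
  refine integral_mono ((integrable_const _).indicator measurableSet_Iio)
    ((integrable_max_sub_zero hμ b').sub (integrable_max_sub_zero hμ b)) fun c => ?_
  rcases lt_or_ge c b with hc | hc
  · simp only [indicator_of_mem (mem_Iio.2 hc), max_eq_left (sub_nonneg.2 hc.le)]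
    linarith [le_max_left (b' - c) 0]
  · simp only [indicator_of_notMem (notMem_Iio.2 hc), max_eq_right (sub_nonpos.2 hc), sub_zero]
    exact le_max_right _ _

lemma expectedExcess_mono (hμ : Integrable id μ) : Monotone (expectedExcess μ) := fun b b' hb => by
  have hincr := real_Iio_mul_sub_le hμ b b'
  linarith [mul_nonneg (measureReal_nonneg (μ := μ) (s := Iio b)) (sub_nonneg.2 hb)]

lemma expectedExcess_strictMonoOn (hμ : Integrable id μ) {a : ℝ}
    (hpos : ∀ b, a < b → 0 < μ.real (Iio b)) : StrictMonoOn (expectedExcess μ) (Ici a) := by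
  intro b (hb : a ≤ b) b' _ hbb'
  have hmid : μ.real (Iio ((b + b') / 2)) * (b' - (b + b') / 2) ≤ _ := real_Iio_mul_sub_le hμ _ _
  have hgap : 0 < μ.real (Iio ((b + b') / 2)) * (b' - (b + b') / 2) :=
    mul_pos (hpos _ (by linarith)) (by linarith)
  linarith [expectedExcess_mono hμ (by linarith : b ≤ (b + b') / 2)]

lemma continuous_expectedExcess (hμ : Integrable id μ) : Continuous (expectedExcess μ) := by
  refine (LipschitzWith.of_le_add_mul (μ univ).toNNReal fun b b' => ?_).continuous
  have hincr : μ.real (Iio b) * (b' - b) ≤ _ := real_Iio_mul_sub_le hμ b b'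
  have hdist : μ.real (Iio b) * (b - b') ≤ μ.real univ * dist b b' := by
    rw [Real.dist_eq]
    exact (mul_le_mul_of_nonneg_left (le_abs_self _) measureReal_nonneg).trans
      (mul_le_mul_of_nonneg_right (measureReal_mono (subset_univ _)) (abs_nonneg _))
  change _ ≤ _ + μ.real univ * dist b b'
  linarith

lemma expectedExcess_le_mul_sq (hμ : Integrable id μ) (hμ₀ : ∀ᵐ c ∂μ, 0 ≤ c) {K : ℝ≥0}
    (hK : μ ≤ K • volume) {b : ℝ} (hb : 0 ≤ b) : expectedExcess μ b ≤ K * b ^ 2 := by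
  have hprob₀ : μ.real (Iio 0) = 0 := by
    rw [measureReal_eq_zero_iff]
    exact measure_mono_null (fun c (hc : c < 0) => hc.not_ge) (ae_iff.1 hμ₀)
  have hprob : μ.real (Iio b) ≤ K * b := by
    simpa [hprob₀, Real.dist_eq, abs_of_nonneg hb, abs_of_nonneg measureReal_nonneg] using
      (lipschitzWith_real_Iio hK).dist_le_mul b 0
  have hincr := real_Iio_mul_sub_le hμ b 0
  rw [expectedExcess_of_nonpos hμ₀ le_rfl] at hincr
  nlinarith

end ExpectedExcess

section AbsolutelyContinuous

variable {a b : ℝ}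

lemma lipschitzOnWith_integral {x : ℝ → ℝ} {K : NNReal} (hx : IntervalIntegrable x volume a b)
    (hK : ∀ u ∈ uIcc a b, |x u| ≤ K) :
    LipschitzOnWith K (fun τ => ∫ u in a..τ, x u) (uIcc a b) := by
  have hint : ∀ u ∈ uIcc a b, IntervalIntegrable x volume a u := fun u hu =>
    hx.mono_set (uIcc_subset_uIcc left_mem_uIcc hu)
  refine LipschitzOnWith.of_dist_le_mul fun u hu v hv => ?_
  rw [Real.dist_eq, Real.dist_eq, intervalIntegral.integral_interval_sub_left (hint u hu)
    (hint v hv)]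
  exact intervalIntegral.norm_integral_le_of_norm_le_const (f := x) fun τ hτ =>
    hK τ (uIcc_subset_uIcc hv hu (uIoc_subset_uIcc hτ))

lemma absolutelyContinuousOnInterval_comp_of_lipschitzOnWith {φ X : ℝ → ℝ} {K : NNReal}
    (hφ : ContDiff ℝ 1 φ) (hX : LipschitzOnWith K X (uIcc a b)) :
    AbsolutelyContinuousOnInterval (fun τ => φ (X τ)) a b := by
  obtain ⟨L, hL⟩ := (hφ.locallyLipschitz.locallyLipschitzOn (s := X '' uIcc a b)
    ).exists_lipschitzOnWith_of_compact (isCompact_uIcc.image_of_continuousOn hX.continuousOn)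
  exact (hL.comp hX (mapsTo_image X _)).absolutelyContinuousOnInterval

lemma intervalIntegrable_and_integral_eq_sub_of_ae_hasDerivAt {F f : ℝ → ℝ}
    (hF : AbsolutelyContinuousOnInterval F a b)
    (hf : ∀ᵐ τ, τ ∈ uIcc a b → HasDerivAt F (f τ) τ) :
    IntervalIntegrable f volume a b ∧ ∫ τ in a..b, f τ = F b - F a := by
  have hderiv : ∀ᵐ τ, τ ∈ uIoc a b → deriv F τ = f τ :=
    hf.mono fun τ h hτ => (h (uIoc_subset_uIcc hτ)).deriv
  exact ⟨hF.intervalIntegrable_deriv.congr_ae ((ae_restrict_iff' measurableSet_uIoc).2 hderiv),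
    (intervalIntegral.integral_congr_ae hderiv).symm.trans hF.integral_deriv_eq_sub⟩

end AbsolutelyContinuous

section Logit

/-- The log-odds of a belief, the inverse of `Real.sigmoid` on `(0, 1)`: Bayes' rule is a
translation in this coordinate. -/
def logit (α : ℝ) : ℝ :=
  Real.log α - Real.log (1 - α)

variable {α : ℝ}

lemma sigmoid_mem_Ioo (x : ℝ) : Real.sigmoid x ∈ Ioo (0 : ℝ) 1 :=
  ⟨Real.sigmoid_pos x, Real.sigmoid_lt_one x⟩

lemma exp_logit (hα : α ∈ Ioo (0 : ℝ) 1) : Real.exp (logit α) = α / (1 - α) := by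
  rw [logit, Real.exp_sub, Real.exp_log hα.1, Real.exp_log (sub_pos.2 hα.2)]

lemma sigmoid_logit (hα : α ∈ Ioo (0 : ℝ) 1) : Real.sigmoid (logit α) = α := by
  have h₀ : α ≠ 0 := hα.1.ne'
  rw [Real.sigmoid_def, Real.exp_neg, exp_logit hα]
  field_simp
  ring

lemma hasDerivAt_logit (hα : α ∈ Ioo (0 : ℝ) 1) : HasDerivAt logit (α * (1 - α))⁻¹ α := by
  have h₀ : α ≠ 0 := hα.1.ne'
  have h₁ : 1 - α ≠ 0 := (sub_pos.2 hα.2).ne'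
  refine ((Real.hasDerivAt_log h₀).sub (((hasDerivAt_id α).const_sub 1).log h₁)).congr_deriv ?_
  simp only [id]
  field_simp
  ring

lemma measurable_logit : Measurable logit :=
  Real.measurable_log.sub (Real.measurable_log.comp (measurable_const.sub measurable_id))

end Logit

namespace Market

section CostLaw

open scoped NNReal

variable (M : Market)

lemma cbar_pos : 0 < M.cbar := by
  have hratio : 0 < M.lam / M.r := div_pos M.lam_pos M.r_pos
  exact (mul_pos (by linarith) (sub_pos.2 M.s_lt)).trans M.cbar_large

lemma exists_h_le : ∃ K : ℝ≥0, ∀ c ∈ Ioo 0 M.cbar, M.h c ≤ K := by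
  obtain ⟨l₀, -, hl₀⟩ := M.h_left
  obtain ⟨l₁, -, hl₁⟩ := M.h_right
  have hcont := M.h_smooth.continuousOn
  obtain ⟨K, hK⟩ := isCompact_Icc.exists_bound_of_continuousOn
    (continuousOn_Icc_extendFrom_Ioo hcont hl₀ hl₁)
  refine ⟨K.toNNReal, fun c hc => ?_⟩
  have hext : extendFrom (Ioo 0 M.cbar) M.h c = M.h c :=
    extendFrom_eq (subset_closure hc) (hcont c hc)
  calc M.h c ≤ K := hext ▸ (le_abs_self _).trans (hK c (Ioo_subset_Icc_self hc))
    _ ≤ K.toNNReal := Real.le_coe_toNNReal K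

/-- The law `H` of the reporting cost, the measure with density `h` on `(0, cbar)`. -/
def costLaw : Measure ℝ :=
  (volume.restrict (Ioo 0 M.cbar)).withDensity fun c => ENNReal.ofReal (M.h c)

lemma h_ae_nonneg : ∀ᵐ c ∂volume.restrict (Ioo 0 M.cbar), 0 ≤ M.h c :=
  (ae_restrict_mem measurableSet_Ioo).mono fun c hc => (M.h_pos c hc).le

lemma aemeasurable_ofReal_h :
    AEMeasurable (fun c => ENNReal.ofReal (M.h c)) (volume.restrict (Ioo 0 M.cbar)) :=
  (M.h_smooth.continuousOn.aemeasurable measurableSet_Ioo).ennreal_ofReal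

lemma expect_eq_integral (f : ℝ → ℝ) : M.expect f = ∫ c, f c ∂M.costLaw := by
  rw [expect, costLaw, integral_withDensity_eq_integral_toReal_smul₀ M.aemeasurable_ofReal_h
    (ae_of_all _ fun _ => ENNReal.ofReal_lt_top), intervalIntegral.integral_of_le M.cbar_pos.le,
    integral_Ioc_eq_integral_Ioo]
  refine integral_congr_ae (M.h_ae_nonneg.mono fun c hc => ?_)
  simp only [smul_eq_mul, ENNReal.toReal_ofReal hc, mul_comm]

instance : IsProbabilityMeasure M.costLaw := by
  have htotal : ∫ c in Ioo 0 M.cbar, M.h c = 1 := by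
    rw [← integral_Ioc_eq_integral_Ioo, ← intervalIntegral.integral_of_le M.cbar_pos.le, M.h_total]
  have hint : Integrable M.h (volume.restrict (Ioo 0 M.cbar)) :=
    not_imp_comm.1 integral_undef (htotal.trans_ne one_ne_zero)
  exact ⟨by rw [costLaw, withDensity_apply _ MeasurableSet.univ, Measure.restrict_univ,
    ← ofReal_integral_eq_lintegral_ofReal hint M.h_ae_nonneg, htotal, ENNReal.ofReal_one]⟩

lemma ae_costLaw_mem : ∀ᵐ c ∂M.costLaw, c ∈ Ioo 0 M.cbar :=
  (withDensity_absolutelyContinuous _ _).ae_le (ae_restrict_mem measurableSet_Ioo)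

lemma ae_costLaw_nonneg : ∀ᵐ c ∂M.costLaw, 0 ≤ c :=
  M.ae_costLaw_mem.mono fun _ hc => hc.1.le

lemma integrable_of_abs_le {f : ℝ → ℝ} (hf : Measurable f) {C : ℝ}
    (hC : ∀ c ∈ Icc 0 M.cbar, |f c| ≤ C) : Integrable f M.costLaw :=
  Integrable.of_bound hf.aestronglyMeasurable C
    (M.ae_costLaw_mem.mono fun c hc => hC c (Ioo_subset_Icc_self hc))

lemma integrable_cost : Integrable id M.costLaw :=
  M.integrable_of_abs_le measurable_id fun _ hc => (abs_of_nonneg hc.1).trans_le hc.2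

lemma exists_costLaw_le : ∃ K : ℝ≥0, M.costLaw ≤ K • volume := by
  obtain ⟨K, hK⟩ := M.exists_h_le
  refine ⟨K, ?_⟩
  calc M.costLaw ≤ (volume.restrict (Ioo 0 M.cbar)).withDensity fun _ => (K : ENNReal) :=
        withDensity_mono ((ae_restrict_mem measurableSet_Ioo).mono fun c hc =>
          ENNReal.ofReal_le_coe.2 (hK c hc))
    _ = K • volume.restrict (Ioo 0 M.cbar) := withDensity_const _
    _ ≤ K • volume := by gcongr; exact Measure.restrict_le_self

lemma real_Iio_costLaw_pos {b : ℝ} (hb : 0 < b) : 0 < M.costLaw.real (Iio b) := by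
  refine ENNReal.toReal_pos (fun hzero => ?_) (measure_ne_top _ _)
  have hempty : volume (Ioo 0 (min b M.cbar)) = 0 := by
    have hae : ∀ᵐ c ∂M.costLaw, c ∉ Iio b := measure_eq_zero_iff_ae_notMem.1 hzero
    rw [costLaw, ae_withDensity_iff' M.aemeasurable_ofReal_h,
      ae_restrict_iff' measurableSet_Ioo] at hae
    refine measure_eq_zero_iff_ae_notMem.2 (hae.mono fun c hc hcb => ?_)
    have hmem : c ∈ Ioo 0 M.cbar := ⟨hcb.1, hcb.2.trans_le (min_le_right _ _)⟩
    exact hc hmem (ENNReal.ofReal_pos.2 (M.h_pos c hmem)).ne' (hcb.2.trans_le (min_le_left _ _))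
  rw [Real.volume_Ioo, ENNReal.ofReal_eq_zero, sub_zero] at hempty
  exact hempty.not_gt (lt_min hb M.cbar_pos)

lemma continuous_real_Iio_costLaw : Continuous fun b => M.costLaw.real (Iio b) :=
  (lipschitzWith_real_Iio M.exists_costLaw_le.choose_spec).continuous

/-- The expected payoff `E (b - c)⁺` of a report worth `b` that is asked for when it covers the
cost. -/
abbrev excess (b : ℝ) : ℝ :=
  expectedExcess M.costLaw b

lemma excess_of_nonpos {b : ℝ} (hb : b ≤ 0) : M.excess b = 0 :=
  expectedExcess_of_nonpos M.ae_costLaw_nonneg hb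

lemma excess_strictMonoOn : StrictMonoOn M.excess (Ici 0) :=
  expectedExcess_strictMonoOn M.integrable_cost fun _ => M.real_Iio_costLaw_pos

lemma strictMono_excess_add_min : StrictMono fun b => M.excess b + min b 0 := by
  intro b b' hb
  rcases le_or_gt 0 b with h | h
  · simpa [h, h.trans hb.le] using M.excess_strictMonoOn h (h.trans hb.le) hb
  · exact add_lt_add_of_le_of_lt (expectedExcess_mono M.integrable_cost hb.le)
      ((min_eq_left h.le).trans_lt (lt_min hb h))

lemma surjective_excess_add_min : Function.Surjective fun b => M.excess b + min b 0 := by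
  have hcont : Continuous fun b => M.excess b + min b 0 :=
    (continuous_expectedExcess M.integrable_cost).add (continuous_id.min continuous_const)
  refine hcont.surjective ?_ ?_
  · refine tendsto_atTop_mono' _ ?_
      (tendsto_id.const_mul_atTop (M.real_Iio_costLaw_pos one_pos) |>.atTop_add
        (tendsto_const_nhds (x := M.excess 1 - M.costLaw.real (Iio 1))))
    filter_upwards [eventually_ge_atTop 0] with b hb
    simp only [min_eq_right hb, id]
    linarith [real_Iio_mul_sub_le M.integrable_cost 1 b]
  · refine tendsto_atBot_mono' _ ?_ tendsto_id
    filter_upwards [eventually_le_atBot 0] with b hb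
    simp [excess_of_nonpos, hb]

/-- `excess` vanishes on the negative half-line; adding `min b 0` makes it invertible. -/
def excessOrderIso : ℝ ≃o ℝ :=
  M.strictMono_excess_add_min.orderIsoOfSurjective _ M.surjective_excess_add_min

/-- The inverse of `excess` on `[0, ∞)`, extended by `0` to negative arguments: the net value of a
report that generates the expected payoff `x`. -/
def excessInv (x : ℝ) : ℝ :=
  M.excessOrderIso.symm (max x 0)

lemma continuous_excessInv : Continuous M.excessInv :=
  M.excessOrderIso.symm.continuous.comp (continuous_id.max continuous_const)

lemma monotone_excessInv : Monotone M.excessInv := fun _ _ h =>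
  M.excessOrderIso.symm.monotone (max_le_max_right 0 h)

lemma excessOrderIso_symm_zero : M.excessOrderIso.symm 0 = 0 := by
  rw [OrderIso.symm_apply_eq]
  change 0 = M.excess 0 + min 0 0
  simp [excess_of_nonpos]

lemma excessInv_of_nonpos {x : ℝ} (hx : x ≤ 0) : M.excessInv x = 0 := by
  rw [excessInv, max_eq_right hx, excessOrderIso_symm_zero]

lemma excessInv_nonneg (x : ℝ) : 0 ≤ M.excessInv x :=
  M.excessOrderIso_symm_zero ▸ M.excessOrderIso.symm.monotone (le_max_right x 0)

lemma excess_excessInv {x : ℝ} (hx : 0 ≤ x) : M.excess (M.excessInv x) = x := by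
  have hinv : M.excess (M.excessInv x) + min (M.excessInv x) 0 = max x 0 :=
    M.excessOrderIso.apply_symm_apply _
  simpa [M.excessInv_nonneg x, hx] using hinv

lemma excessInv_pos {x : ℝ} (hx : 0 < x) : 0 < M.excessInv x := by
  refine (M.excessInv_nonneg x).lt_of_ne fun h => hx.ne ?_
  rw [← M.excess_excessInv hx.le, ← h, M.excess_of_nonpos le_rfl]

lemma exists_mul_sqrt_le_excessInv : ∃ κ > 0, ∀ x, 0 ≤ x → κ * √x ≤ M.excessInv x := by
  obtain ⟨K, hK⟩ := M.exists_costLaw_le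
  have hK₁ : (0 : ℝ) < K + 1 := by positivity
  refine ⟨(√(K + 1))⁻¹, by positivity, fun x hx => ?_⟩
  have hsq : x ≤ (K + 1) * M.excessInv x ^ 2 := by
    have hquad : M.excess (M.excessInv x) ≤ K * M.excessInv x ^ 2 :=
      expectedExcess_le_mul_sq M.integrable_cost M.ae_costLaw_nonneg hK (M.excessInv_nonneg x)
    rw [M.excess_excessInv hx] at hquad
    linarith [sq_nonneg (M.excessInv x)]
  rw [inv_mul_le_iff₀ (by positivity)]
  calc √x ≤ √((K + 1) * M.excessInv x ^ 2) := Real.sqrt_le_sqrt hsq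
    _ = √(K + 1) * M.excessInv x := by
      rw [Real.sqrt_mul hK₁.le, Real.sqrt_sq (M.excessInv_nonneg x)]

end CostLaw

section Bellman

variable (M : Market)

/-- The expected flow utility `g = λ z` of the risky product in the good state. -/
def g : ℝ :=
  M.lam * M.z

lemma s_lt_g : M.s < M.g :=
  M.s_lt

lemma g_pos : 0 < M.g :=
  M.s_pos.trans M.s_lt

/-- The flow utility of the myopically better product. -/
def myopic (α : ℝ) : ℝ :=
  max M.s (M.g * α)

/-- The flow utility given up by choosing the risky product. -/
def loss (α : ℝ) : ℝ :=
  M.myopic α - M.g * α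

lemma myopic_eq_safe {α : ℝ} (h : M.g * α ≤ M.s) : M.myopic α = M.s :=
  max_eq_left h

lemma myopic_eq_risky {α : ℝ} (h : M.s ≤ M.g * α) : M.myopic α = M.g * α :=
  max_eq_right h

lemma safe_le_myopic (α : ℝ) : M.s ≤ M.myopic α :=
  le_max_left _ _

lemma loss_nonneg (α : ℝ) : 0 ≤ M.loss α :=
  sub_nonneg.2 (le_max_right _ _)

lemma continuous_myopic : Continuous M.myopic :=
  continuous_const.max (continuous_const.mul continuous_id)

lemma monotone_myopic : Monotone M.myopic := fun _ _ h =>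
  max_le_max_left _ (mul_le_mul_of_nonneg_left h M.g_pos.le)

lemma antitone_loss : Antitone M.loss := fun α β h => by
  have hg := mul_le_mul_of_nonneg_left h M.g_pos.le
  simp only [loss, myopic]
  rcases max_cases M.s (M.g * β) with hβ | hβ <;> linarith [le_max_left M.s (M.g * α),
    le_max_right M.s (M.g * α)]

/-- `λ α (1 - α) W'(α)` as a function of `α` and of the value `x = W α`. The Bellman equation
`r x = myopic α + excess (b - loss α)`, where `b = λ α (g / r - x) - λ α (1 - α) W'(α)` is the net
value of a report, is solved for the derivative. -/
def valueDrift (α x : ℝ) : ℝ :=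
  M.lam * α * (M.g / M.r - x) - M.loss α - M.excessInv (M.r * x - M.myopic α)

/-- The belief at which `valueDrift` vanishes when the value is that of the safe product. -/
def safeCutoff : ℝ :=
  M.s / (M.lam * ((M.g - M.s) / M.r) + M.g)

lemma learning_pos : 0 < M.lam * ((M.g - M.s) / M.r) :=
  mul_pos M.lam_pos (div_pos (sub_pos.2 M.s_lt_g) M.r_pos)

lemma safeCutoff_pos : 0 < M.safeCutoff :=
  div_pos M.s_pos (add_pos M.learning_pos M.g_pos)

lemma safeCutoff_lt : M.safeCutoff < M.s / M.g :=
  div_lt_div_of_pos_left M.s_pos M.g_pos (lt_add_of_pos_left _ M.learning_pos)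

lemma safe_div_g_lt_one : M.s / M.g < 1 :=
  (div_lt_one M.g_pos).2 M.s_lt_g

lemma safeCutoff_mem : M.safeCutoff ∈ Ioo (0 : ℝ) 1 :=
  ⟨M.safeCutoff_pos, M.safeCutoff_lt.trans M.safe_div_g_lt_one⟩

lemma Icc_safeCutoff_subset {t : ℝ} (ht : t < 1) : Icc M.safeCutoff t ⊆ Ioo 0 1 := fun _ hτ =>
  ⟨M.safeCutoff_pos.trans_le hτ.1, hτ.2.trans_lt ht⟩

lemma g_mul_le_of_le_safeCutoff {α : ℝ} (h : α ≤ M.safeCutoff) : M.g * α ≤ M.s :=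
  (le_div_iff₀' M.g_pos).1 (h.trans M.safeCutoff_lt.le)

lemma valueDrift_safe (α : ℝ) :
    M.valueDrift α (M.s / M.r) = α * (M.lam * ((M.g - M.s) / M.r)) - M.loss α := by
  rw [valueDrift, mul_div_cancel₀ _ M.r_pos.ne',
    M.excessInv_of_nonpos (sub_nonpos.2 (M.safe_le_myopic α))]
  ring

lemma valueDrift_safe_nonpos {α : ℝ} (h : α ≤ M.safeCutoff) :
    M.valueDrift α (M.s / M.r) ≤ 0 := by
  have hα := (le_div_iff₀ (add_pos M.learning_pos M.g_pos)).1 h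
  rw [valueDrift_safe, loss, M.myopic_eq_safe (M.g_mul_le_of_le_safeCutoff h)]
  linarith

lemma valueDrift_safe_pos {α : ℝ} (h : M.safeCutoff < α) : 0 < M.valueDrift α (M.s / M.r) := by
  have hα := (div_lt_iff₀ (add_pos M.learning_pos M.g_pos)).1 h
  have hpos := mul_pos (M.safeCutoff_pos.trans h) M.learning_pos
  rw [valueDrift_safe, loss, myopic]
  rcases max_cases M.s (M.g * α) with hm | hm <;> linarith

lemma valueDrift_safeCutoff : M.valueDrift M.safeCutoff (M.s / M.r) = 0 := by
  have hα := div_mul_cancel₀ M.s (add_pos M.learning_pos M.g_pos).ne'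
  rw [valueDrift_safe, loss, M.myopic_eq_safe (M.g_mul_le_of_le_safeCutoff le_rfl), safeCutoff]
  linarith

lemma valueDrift_risky_nonpos (α : ℝ) : M.valueDrift α (M.g / M.r) ≤ 0 := by
  rw [valueDrift, sub_self, mul_zero]
  linarith [M.loss_nonneg α, M.excessInv_nonneg (M.r * (M.g / M.r) - M.myopic α)]

lemma valueDrift_myopic_of_safe_le {α : ℝ} (h : M.s ≤ M.g * α) :
    M.valueDrift α (M.myopic α / M.r) = M.g / M.r * (M.lam * (α * (1 - α))) := by
  rw [valueDrift, mul_div_cancel₀ _ M.r_pos.ne', sub_self, M.excessInv_of_nonpos le_rfl, loss,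
    M.myopic_eq_risky h]
  ring

lemma antitone_valueDrift {α : ℝ} (hα : 0 ≤ α) : Antitone (M.valueDrift α) := fun x y h => by
  have hlearn := mul_le_mul_of_nonneg_left h (mul_nonneg M.lam_pos.le hα)
  have hinv := M.monotone_excessInv
    (sub_le_sub_right (mul_le_mul_of_nonneg_left h M.r_pos.le) (M.myopic α))
  simp only [valueDrift]
  linarith

lemma monotone_valueDrift {x : ℝ} (hx : x ≤ M.g / M.r) :
    Monotone fun α => M.valueDrift α x := fun α β h => by
  have hlearn := mul_le_mul_of_nonneg_right (mul_le_mul_of_nonneg_left h M.lam_pos.le)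
    (sub_nonneg.2 hx)
  have hinv := M.monotone_excessInv (sub_le_sub_left (M.monotone_myopic h) (M.r * x))
  simp only [valueDrift]
  linarith [M.antitone_loss h]

lemma continuous_valueDrift : Continuous ↿M.valueDrift := by
  have hm := M.continuous_myopic
  have hΦ := M.continuous_excessInv
  change Continuous fun p : ℝ × ℝ => M.valueDrift p.1 p.2
  unfold valueDrift loss
  fun_prop

/-- The derivative `W'(α)` as a function of `α` and of the value `x = W α`. Negative drifts are
replaced by `0`: no report is worth its cost there. -/
def valueSlope (α x : ℝ) : ℝ :=
  max 0 (M.valueDrift α x) / (M.lam * (α * (1 - α)))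

lemma scale_pos {α : ℝ} (hα : α ∈ Ioo (0 : ℝ) 1) : 0 < M.lam * (α * (1 - α)) :=
  mul_pos M.lam_pos (mul_pos hα.1 (sub_pos.2 hα.2))

lemma scale_mul_valueSlope {α : ℝ} (hα : α ∈ Ioo (0 : ℝ) 1) (x : ℝ) :
    M.lam * (α * (1 - α)) * M.valueSlope α x = max 0 (M.valueDrift α x) :=
  mul_div_cancel₀ _ (M.scale_pos hα).ne'

lemma valueSlope_nonneg {α : ℝ} (hα : α ∈ Ioo (0 : ℝ) 1) (x : ℝ) : 0 ≤ M.valueSlope α x :=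
  div_nonneg (le_max_left _ _) (M.scale_pos hα).le

lemma valueSlope_eq_zero {α x : ℝ} (h : M.valueDrift α x ≤ 0) : M.valueSlope α x = 0 := by
  rw [valueSlope, max_eq_left h, zero_div]

lemma valueSlope_myopic_of_safe_le {α : ℝ} (hα : α ∈ Ioo (0 : ℝ) 1) (h : M.s ≤ M.g * α) :
    M.valueSlope α (M.myopic α / M.r) = M.g / M.r := by
  have hscale := M.scale_pos hα
  rw [valueSlope, M.valueDrift_myopic_of_safe_le h,
    max_eq_right (mul_pos (div_pos M.g_pos M.r_pos) hscale).le, mul_div_cancel_right₀ _ hscale.ne']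

lemma monotoneOn_of_hasDerivAt_valueSlope {u y : ℝ → ℝ}
    (hu : ∀ t ∈ Ioo (0 : ℝ) 1, HasDerivAt u (M.valueSlope t (y t)) t) :
    MonotoneOn u (Ioo 0 1) :=
  monotoneOn_of_hasDerivWithinAt_nonneg (convex_Ioo 0 1) (HasDerivAt.continuousOn hu)
    (fun t ht => (hu t (interior_subset ht)).hasDerivWithinAt)
    fun _ ht => M.valueSlope_nonneg (interior_subset ht) _

/-- The value is bounded below by that of the myopic choice; building this bound into the equation
makes its right-hand side, in log-odds, bounded and continuous. -/
lemma exists_hasDerivAt_valueSlope_max :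
    ∃ u : ℝ → ℝ, Measurable u ∧ u M.safeCutoff = M.s / M.r ∧ ∀ t ∈ Ioo (0 : ℝ) 1,
      HasDerivAt u (M.valueSlope t (max (u t) (M.myopic t / M.r))) t := by
  set F : ℝ → ℝ → ℝ := fun θ x => max 0 (M.valueDrift (Real.sigmoid θ)
    (max x (M.myopic (Real.sigmoid θ) / M.r))) / M.lam with hF
  have hcont : Continuous ↿F := by
    have hm := M.continuous_myopic
    refine (continuous_const.max (M.continuous_valueDrift.comp
      (?_ : Continuous fun p : ℝ × ℝ => (Real.sigmoid p.1,
        max p.2 (M.myopic (Real.sigmoid p.1) / M.r))))).div_const _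
    fun_prop
  have hbound : ∀ θ x, |F θ x| ≤ ((M.g - M.s) / M.r).toNNReal := by
    intro θ x
    have hσ := sigmoid_mem_Ioo θ
    have hsafe : M.s / M.r ≤ max x (M.myopic (Real.sigmoid θ) / M.r) :=
      le_max_of_le_right (div_le_div_of_nonneg_right (M.safe_le_myopic _) M.r_pos.le)
    have hdrift := M.antitone_valueDrift hσ.1.le hsafe
    have hle := mul_le_mul_of_nonneg_right hσ.2.le M.learning_pos.le
    rw [valueDrift_safe] at hdrift
    rw [abs_of_nonneg (div_nonneg (le_max_left _ _) M.lam_pos.le), div_le_iff₀' M.lam_pos]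
    refine (max_le M.learning_pos.le ?_).trans
      (mul_le_mul_of_nonneg_left (Real.le_coe_toNNReal _) M.lam_pos.le)
    linarith [M.loss_nonneg (Real.sigmoid θ)]
  obtain ⟨v, hv₀, hv⟩ := exists_hasDerivAt_of_continuous_of_bounded hcont hbound
    (logit M.safeCutoff) (M.s / M.r)
  have hvm : Measurable v :=
    (continuous_iff_continuousAt.2 fun θ => (hv θ).continuousAt).measurable
  refine ⟨v ∘ logit, hvm.comp measurable_logit, hv₀, fun t ht => ?_⟩
  refine ((hv _).comp t (hasDerivAt_logit ht)).congr_deriv ?_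
  simp only [hF, sigmoid_logit ht, valueSlope, Function.comp_apply, div_eq_mul_inv, mul_inv]
  ring

/-- `w` solves the planner's Bellman equation with the value `s / r` of the safe product at the
cutoff belief. Its values outside `(0, 1)` are irrelevant. -/
structure IsBellmanSolution (w : ℝ → ℝ) : Prop where
  measurable : Measurable w
  apply_safeCutoff : w M.safeCutoff = M.s / M.r
  hasDerivAt : ∀ t ∈ Ioo (0 : ℝ) 1, HasDerivAt w (M.valueSlope t (w t)) t
  myopic_le : ∀ t ∈ Ioo (0 : ℝ) 1, M.myopic t ≤ M.r * w t

lemma eq_safe_of_hasDerivAt_valueSlope_max {u : ℝ → ℝ} (hu₀ : u M.safeCutoff = M.s / M.r)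
    (hu : ∀ t ∈ Ioo (0 : ℝ) 1,
      HasDerivAt u (M.valueSlope t (max (u t) (M.myopic t / M.r))) t)
    {t : ℝ} (ht : t ∈ Ioc 0 M.safeCutoff) : u t = M.s / M.r := by
  have hsub : Icc t M.safeCutoff ⊆ Ioo 0 1 := fun τ hτ =>
    ⟨ht.1.trans_le hτ.1, hτ.2.trans_lt M.safeCutoff_mem.2⟩
  have hzero : ∀ τ ∈ Ico t M.safeCutoff, HasDerivWithinAt u 0 (Ici τ) τ := by
    intro τ hτ
    have hτ' := hsub (Ico_subset_Icc_self hτ)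
    have hle : u τ ≤ M.s / M.r :=
      hu₀ ▸ M.monotoneOn_of_hasDerivAt_valueSlope hu hτ' M.safeCutoff_mem hτ.2.le
    have hslope := hu τ hτ'
    rw [M.myopic_eq_safe (M.g_mul_le_of_le_safeCutoff hτ.2.le), max_eq_right hle,
      M.valueSlope_eq_zero (M.valueDrift_safe_nonpos hτ.2.le)] at hslope
    exact hslope.hasDerivWithinAt
  rw [← hu₀, constant_of_has_deriv_right_zero
    (fun τ hτ => (hu τ (hsub hτ)).continuousAt.continuousWithinAt) hzero _
    (right_mem_Icc.2 ht.2)]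

lemma myopic_le_of_hasDerivAt_valueSlope_max {u : ℝ → ℝ} (hu₀ : u M.safeCutoff = M.s / M.r)
    (hu : ∀ t ∈ Ioo (0 : ℝ) 1,
      HasDerivAt u (M.valueSlope t (max (u t) (M.myopic t / M.r))) t)
    {t : ℝ} (ht : t ∈ Ioo (0 : ℝ) 1) : M.myopic t ≤ M.r * u t := by
  rcases le_total t M.safeCutoff with hle | hge
  · rw [M.eq_safe_of_hasDerivAt_valueSlope_max hu₀ hu ⟨ht.1, hle⟩, mul_div_cancel₀ _ M.r_pos.ne',
      M.myopic_eq_safe (M.g_mul_le_of_le_safeCutoff hle)]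
  have hsub := M.Icc_safeCutoff_subset ht.2
  have hsafe : ∀ τ ∈ Icc M.safeCutoff t, M.s ≤ M.r * u τ := fun τ hτ => by
    rw [← div_le_iff₀' M.r_pos, ← hu₀]
    exact M.monotoneOn_of_hasDerivAt_valueSlope hu M.safeCutoff_mem (hsub hτ) hτ.1
  have hrisky : 0 ≤ M.r * u t - M.g * t := by
    refine nonneg_of_hasDerivAt_nonneg_of_neg (f := fun τ => M.r * u τ - M.g * τ) hge
      (fun τ hτ => ((hu τ (hsub hτ)).const_mul M.r).sub ((hasDerivAt_id τ).const_mul M.g)) ?_ ?_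
    · rw [hu₀, mul_div_cancel₀ _ M.r_pos.ne']
      exact sub_nonneg.2 (M.g_mul_le_of_le_safeCutoff le_rfl)
    · intro τ hτ hneg
      have hτ' := Ioo_subset_Icc_self hτ
      have hg : M.s ≤ M.g * τ := (hsafe τ hτ').trans (sub_neg.1 hneg).le
      have hclip : u τ ≤ M.myopic τ / M.r := by
        rw [le_div_iff₀' M.r_pos, M.myopic_eq_risky hg]
        exact (sub_neg.1 hneg).le
      rw [max_eq_right hclip, M.valueSlope_myopic_of_safe_le (hsub hτ') hg,
        mul_div_cancel₀ _ M.r_pos.ne', mul_one, sub_self]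
  exact max_le (hsafe t (right_mem_Icc.2 hge)) (sub_nonneg.1 hrisky)

theorem exists_isBellmanSolution : ∃ w, M.IsBellmanSolution w := by
  obtain ⟨u, hmeas, hu₀, hu⟩ := M.exists_hasDerivAt_valueSlope_max
  have hmyopic := fun t ht => M.myopic_le_of_hasDerivAt_valueSlope_max hu₀ hu (t := t) ht
  refine ⟨u, hmeas, hu₀, fun t ht => ?_, hmyopic⟩
  simpa only [max_eq_left ((div_le_iff₀' M.r_pos).2 (hmyopic t ht))] using hu t ht

end Bellman

section ValueFunction

variable {M : Market}

namespace IsBellmanSolution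

variable {w : ℝ → ℝ} {t : ℝ}

lemma continuousOn (hw : M.IsBellmanSolution w) : ContinuousOn w (Ioo 0 1) := fun t ht =>
  (hw.hasDerivAt t ht).continuousAt.continuousWithinAt

lemma monotoneOn (hw : M.IsBellmanSolution w) : MonotoneOn w (Ioo 0 1) :=
  M.monotoneOn_of_hasDerivAt_valueSlope hw.hasDerivAt

lemma eq_safe (hw : M.IsBellmanSolution w) (ht : t ∈ Ioc 0 M.safeCutoff) : w t = M.s / M.r := by
  have ht' : t ∈ Ioo (0 : ℝ) 1 := ⟨ht.1, ht.2.trans_lt M.safeCutoff_mem.2⟩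
  refine le_antisymm (hw.apply_safeCutoff ▸ hw.monotoneOn ht' M.safeCutoff_mem ht.2) ?_
  exact (div_le_iff₀' M.r_pos).2 ((M.safe_le_myopic t).trans (hw.myopic_le t ht'))

lemma safe_lt (hw : M.IsBellmanSolution w) (ht : t ∈ Ioo M.safeCutoff 1) : M.s / M.r < w t := by
  by_contra! hle
  have hconst : ∀ τ ∈ Icc M.safeCutoff t, w τ = M.s / M.r := fun τ hτ => by
    have hsub := M.Icc_safeCutoff_subset ht.2
    have hle' := hw.monotoneOn (hsub hτ) (hsub (right_mem_Icc.2 ht.1.le)) hτ.2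
    refine le_antisymm (hle'.trans hle) ?_
    exact hw.apply_safeCutoff ▸ hw.monotoneOn M.safeCutoff_mem (hsub hτ) hτ.1
  obtain ⟨τ, hτ⟩ := nonempty_Ioo.2 ht.1
  have hτ' := M.Icc_safeCutoff_subset ht.2 (Ioo_subset_Icc_self hτ)
  have hderiv : HasDerivAt w 0 τ := (hasDerivAt_const τ (M.s / M.r)).congr_of_eventuallyEq
    (eventually_of_mem (Icc_mem_nhds hτ.1 hτ.2) hconst)
  have hdrift := M.scale_mul_valueSlope hτ' (w τ)
  rw [(hw.hasDerivAt τ hτ').unique hderiv, mul_zero, hconst τ (Ioo_subset_Icc_self hτ)] at hdrift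
  exact (M.valueDrift_safe_pos hτ.1).not_ge (max_eq_left_iff.1 hdrift.symm)

lemma le_risky (hw : M.IsBellmanSolution w) (ht : t ∈ Ioo (0 : ℝ) 1) : w t ≤ M.g / M.r := by
  rcases le_total t M.safeCutoff with hle | hge
  · rw [hw.eq_safe ⟨ht.1, hle⟩]
    exact div_le_div_of_nonneg_right M.s_lt_g.le M.r_pos.le
  have hsub := M.Icc_safeCutoff_subset ht.2
  refine sub_nonneg.1 (nonneg_of_hasDerivAt_nonneg_of_neg (f := fun τ => M.g / M.r - w τ) hge
    (fun τ hτ => (hw.hasDerivAt τ (hsub hτ)).const_sub _) ?_ fun τ hτ hneg => ?_)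
  · rw [hw.apply_safeCutoff]
    exact sub_nonneg.2 (div_le_div_of_nonneg_right M.s_lt_g.le M.r_pos.le)
  · have hτ' := hsub (Ioo_subset_Icc_self hτ)
    rw [M.valueSlope_eq_zero ((M.antitone_valueDrift hτ'.1.le (sub_neg.1 hneg).le).trans
      (M.valueDrift_risky_nonpos τ)), neg_zero]

lemma valueDrift_nonneg (hw : M.IsBellmanSolution w) (ht : t ∈ Ico M.safeCutoff 1) :
    0 ≤ M.valueDrift t (w t) := by
  by_contra! hneg
  have hsub := M.Icc_safeCutoff_subset ht.2
  have hcont : ContinuousOn (fun τ => M.valueDrift τ (w τ)) (Icc M.safeCutoff t) :=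
    M.continuous_valueDrift.comp_continuousOn
      (continuousOn_id.prodMk (hw.continuousOn.mono hsub))
  obtain ⟨y, hy, hyd, hlast⟩ := exists_last_nonneg ht.1 hcont
    (by rw [hw.apply_safeCutoff, M.valueDrift_safeCutoff]) hneg
  have hyt : Icc y t ⊆ Icc M.safeCutoff t := Icc_subset_Icc_left hy.1
  have hconst : w t = w y := by
    obtain ⟨c, hc, hslope⟩ := exists_hasDerivAt_eq_slope w _ hy.2
      (hw.continuousOn.mono (hyt.trans hsub))
      fun τ hτ => hw.hasDerivAt τ (hsub (hyt (Ioo_subset_Icc_self hτ)))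
    rw [M.valueSlope_eq_zero (hlast c (Ioo_subset_Ioc_self hc)).le, eq_comm,
      div_eq_zero_iff] at hslope
    exact sub_eq_zero.1 (hslope.resolve_right (sub_pos.2 hy.2).ne')
  have hmono := M.monotone_valueDrift
    (hw.le_risky (hsub (hyt (left_mem_Icc.2 hy.2.le)))) hy.2.le
  exact (hyd.trans hmono).not_gt (hconst ▸ hneg)

lemma scale_mul_valueSlope (hw : M.IsBellmanSolution w) (ht : t ∈ Ico M.safeCutoff 1) :
    M.lam * (t * (1 - t)) * M.valueSlope t (w t) = M.valueDrift t (w t) := by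
  rw [M.scale_mul_valueSlope ⟨M.safeCutoff_pos.trans_le ht.1, ht.2⟩,
    max_eq_right (hw.valueDrift_nonneg ht)]

end IsBellmanSolution

section Gain

variable (M) in
lemma Ico_safe_div_g_subset : Ico (M.s / M.g) 1 ⊆ Ioo 0 1 :=
  Ico_subset_Ioo_left (div_pos M.s_pos M.g_pos)

variable (M) in
lemma myopic_of_safe_div_g_le {t : ℝ} (ht : M.s / M.g ≤ t) : M.myopic t = M.g * t :=
  M.myopic_eq_risky ((div_le_iff₀' M.g_pos).1 ht)

variable (M) in
/-- The flow gain of the value `w` over the risky product without reports. -/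
def gain (w : ℝ → ℝ) (t : ℝ) : ℝ :=
  M.r * w t - M.g * t

variable (M) in
/-- The derivative of `gain`, by the Bellman equation. -/
def gainSlope (w : ℝ → ℝ) (t : ℝ) : ℝ :=
  -(M.gain w t / (1 - t) + M.r * M.excessInv (M.gain w t) / (M.lam * (t * (1 - t))))

variable {w : ℝ → ℝ} {t : ℝ}

namespace IsBellmanSolution

lemma gain_nonneg (hw : M.IsBellmanSolution w) (ht : t ∈ Ico (M.s / M.g) 1) :
    0 ≤ M.gain w t :=
  sub_nonneg.2 (M.myopic_of_safe_div_g_le ht.1 ▸ hw.myopic_le t (M.Ico_safe_div_g_subset ht))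

lemma hasDerivAt_gain (hw : M.IsBellmanSolution w) (ht : t ∈ Ico (M.s / M.g) 1) :
    HasDerivAt (M.gain w) (M.gainSlope w t) t := by
  have ht' := M.Ico_safe_div_g_subset ht
  refine (((hw.hasDerivAt t ht').const_mul M.r).sub
    ((hasDerivAt_id t).const_mul M.g)).congr_deriv ?_
  have hslope := hw.scale_mul_valueSlope ⟨M.safeCutoff_lt.le.trans ht.1, ht.2⟩
  have hr := M.r_pos.ne'
  have hlam := M.lam_pos.ne'
  have ht₀ : t ≠ 0 := ht'.1.ne'
  have ht₁ : 1 - t ≠ 0 := (sub_pos.2 ht.2).ne'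
  rw [valueDrift, loss, M.myopic_of_safe_div_g_le ht.1, ← gain] at hslope
  rw [eq_div_of_mul_eq (M.scale_pos ht').ne' ((mul_comm _ _).trans hslope), gainSlope]
  simp only [gain]
  field_simp
  ring

lemma antitoneOn_gain (hw : M.IsBellmanSolution w) : AntitoneOn (M.gain w) (Ico (M.s / M.g) 1) := by
  refine antitoneOn_of_hasDerivWithinAt_nonpos (convex_Ico _ _)
    (HasDerivAt.continuousOn fun t ht => hw.hasDerivAt_gain ht)
    (fun t ht => (hw.hasDerivAt_gain (interior_subset ht)).hasDerivWithinAt) fun t ht => ?_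
  have ht' := interior_subset ht
  exact neg_nonpos.2 <| add_nonneg (div_nonneg (hw.gain_nonneg ht') (sub_pos.2 ht'.2).le)
    (div_nonneg (mul_nonneg M.r_pos.le (M.excessInv_nonneg _))
      (M.scale_pos (M.Ico_safe_div_g_subset ht')).le)

lemma exists_gain_nonpos (hw : M.IsBellmanSolution w) :
    ∃ t ∈ Ico (M.s / M.g) 1, M.gain w t ≤ 0 := by
  obtain ⟨κ, hκ, hsqrt⟩ := M.exists_mul_sqrt_le_excessInv
  have hκ' : 0 < M.r * κ / M.lam := div_pos (mul_pos M.r_pos hκ) M.lam_pos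
  refine exists_nonpos_of_hasDerivAt_le_neg_sqrt_div M.safe_div_g_lt_one hκ'
    (fun t ht => hw.hasDerivAt_gain ht) fun t ht hpos => neg_le_neg ?_
  have ht₁ : 0 < 1 - t := sub_pos.2 ht.2
  have hinv := mul_nonneg M.r_pos.le (M.excessInv_nonneg (M.gain w t))
  calc M.r * κ / M.lam * √(M.gain w t) / (1 - t)
      = M.r * (κ * √(M.gain w t)) / (M.lam * (1 - t)) := by
        have hlam := M.lam_pos.ne'
        field_simp
    _ ≤ M.r * M.excessInv (M.gain w t) / (M.lam * (1 - t)) :=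
        div_le_div_of_nonneg_right (mul_le_mul_of_nonneg_left (hsqrt _ hpos.le) M.r_pos.le)
          (mul_pos M.lam_pos ht₁).le
    _ ≤ M.r * M.excessInv (M.gain w t) / (M.lam * (t * (1 - t))) :=
        div_le_div_of_nonneg_left hinv (M.scale_pos (M.Ico_safe_div_g_subset ht))
          (mul_le_mul_of_nonneg_left (mul_le_of_le_one_left ht₁.le ht.2.le) M.lam_pos.le)
    _ ≤ _ := le_add_of_nonneg_left (div_nonneg hpos.le ht₁.le)

lemma gain_safe_div_g_pos (hw : M.IsBellmanSolution w) : 0 < M.gain w (M.s / M.g) := by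
  have hlt := hw.safe_lt ⟨M.safeCutoff_lt, M.safe_div_g_lt_one⟩
  rw [div_lt_iff₀' M.r_pos] at hlt
  rwa [gain, mul_div_cancel₀ _ M.g_pos.ne', sub_pos]

theorem exists_riskyCutoff (hw : M.IsBellmanSolution w) : ∃ a ∈ Ioo (M.s / M.g) 1,
    (∀ t ∈ Ioo M.safeCutoff a, M.myopic t < M.r * w t) ∧
      ∀ t ∈ Ico a 1, M.r * w t = M.myopic t := by
  obtain ⟨b, hb, hbgain⟩ := hw.exists_gain_nonpos
  have hcont : ContinuousOn (M.gain w) (Icc (M.s / M.g) b) := fun t ht =>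
    (hw.hasDerivAt_gain ⟨ht.1, ht.2.trans_lt hb.2⟩).continuousAt.continuousWithinAt
  obtain ⟨a, ⟨ha, hagain⟩, hleast⟩ := (isCompact_Icc.of_isClosed_subset
    (hcont.preimage_isClosed_of_isClosed isClosed_Icc isClosed_Iic)
    inter_subset_left).exists_isLeast ⟨b, right_mem_Icc.2 hb.1, hbgain⟩
  have ha₁ : a < 1 := ha.2.trans_lt hb.2
  have hlt : M.s / M.g < a := ha.1.lt_of_ne fun h => by
    subst h
    exact hw.gain_safe_div_g_pos.not_ge hagain
  refine ⟨a, ⟨hlt, ha₁⟩, fun t ht => ?_, fun t ht => ?_⟩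
  · rcases le_total t (M.s / M.g) with hle | hge
    · rw [M.myopic_eq_safe ((le_div_iff₀' M.g_pos).1 hle), ← div_lt_iff₀' M.r_pos]
      exact hw.safe_lt ⟨ht.1, ht.2.trans ha₁⟩
    · rw [M.myopic_of_safe_div_g_le hge, ← sub_pos]
      exact not_le.1 fun hgain => ht.2.not_ge (hleast ⟨⟨hge, ht.2.le.trans ha.2⟩, hgain⟩)
  · have ht' : t ∈ Ico (M.s / M.g) 1 := ⟨hlt.le.trans ht.1, ht.2⟩
    have hgain : M.gain w t = 0 := le_antisymm
      ((hw.antitoneOn_gain ⟨hlt.le, ha₁⟩ ht' ht.1).trans hagain) (hw.gain_nonneg ht')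
    rw [M.myopic_of_safe_div_g_le ht'.1, ← sub_eq_zero, ← gain, hgain]

end IsBellmanSolution

end Gain

end ValueFunction

section ReportCutoff

variable (M : Market)

/-- The net value of one more report, `λ α (g / r - w α) - λ α (1 - α) w'(α)`, when the value
function `w` solves the Bellman equation; see `Market.B`. -/
def reportValue (w : ℝ → ℝ) (α : ℝ) : ℝ :=
  M.lam * α * (M.g / M.r - w α) - M.lam * (α * (1 - α)) * M.valueSlope α (w α)

/-- The cost below which reports are collected, when the value function is `w`. -/
def reportCutoff (w : ℝ → ℝ) (α : ℝ) : ℝ :=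
  M.excessInv (M.r * w α - M.myopic α)

variable {M} {w : ℝ → ℝ} {α : ℝ}

lemma reportCutoff_nonneg : 0 ≤ M.reportCutoff w α :=
  M.excessInv_nonneg _

namespace IsBellmanSolution

lemma measurable_reportCutoff (hw : M.IsBellmanSolution w) : Measurable (M.reportCutoff w) :=
  M.continuous_excessInv.measurable.comp
    ((hw.measurable.const_mul _).sub M.continuous_myopic.measurable)

lemma continuousOn_reportCutoff (hw : M.IsBellmanSolution w) :
    ContinuousOn (M.reportCutoff w) (Ioo 0 1) :=
  M.continuous_excessInv.comp_continuousOn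
    ((hw.continuousOn.const_smul M.r).sub M.continuous_myopic.continuousOn)

lemma reportCutoff_eq_zero (hw : M.IsBellmanSolution w) (hα : α ∈ Ioc 0 M.safeCutoff) :
    M.reportCutoff w α = 0 := by
  rw [reportCutoff, hw.eq_safe hα, mul_div_cancel₀ _ M.r_pos.ne',
    M.excessInv_of_nonpos (sub_nonpos.2 (M.safe_le_myopic α))]

lemma reportValue_sub_loss_nonpos (hw : M.IsBellmanSolution w) (hα : α ∈ Ioc 0 M.safeCutoff) :
    M.reportValue w α - M.loss α ≤ 0 := by
  have hdrift := M.valueDrift_safe_nonpos hα.2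
  rw [reportValue, hw.eq_safe hα, M.valueSlope_eq_zero hdrift]
  rw [valueDrift_safe] at hdrift
  linarith [sub_div M.g M.s M.r, congrArg (fun x => α * (M.lam * x)) (sub_div M.g M.s M.r)]

lemma reportCutoff_eq_sub (hw : M.IsBellmanSolution w) (hα : α ∈ Ico M.safeCutoff 1) :
    M.reportCutoff w α = M.reportValue w α - M.loss α := by
  rw [reportCutoff, reportValue, hw.scale_mul_valueSlope hα, valueDrift]
  ring

lemma reportCutoff_eq_max (hw : M.IsBellmanSolution w) (hα : α ∈ Ioo (0 : ℝ) 1) :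
    M.reportCutoff w α = max (M.reportValue w α - M.loss α) 0 := by
  rcases le_total α M.safeCutoff with hle | hge
  · rw [hw.reportCutoff_eq_zero ⟨hα.1, hle⟩,
      max_eq_right (hw.reportValue_sub_loss_nonpos ⟨hα.1, hle⟩)]
  · rw [← hw.reportCutoff_eq_sub ⟨hge, hα.2⟩, max_eq_left reportCutoff_nonneg]

lemma myopic_add_excess (hw : M.IsBellmanSolution w) (hα : α ∈ Ioo (0 : ℝ) 1) :
    M.myopic α + M.excess (M.reportValue w α - M.loss α) = M.r * w α := by
  rcases le_total α M.safeCutoff with hle | hge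
  · rw [M.excess_of_nonpos (hw.reportValue_sub_loss_nonpos ⟨hα.1, hle⟩), hw.eq_safe ⟨hα.1, hle⟩,
      M.myopic_eq_safe (M.g_mul_le_of_le_safeCutoff hle), mul_div_cancel₀ _ M.r_pos.ne', add_zero]
  · rw [← hw.reportCutoff_eq_sub ⟨hge, hα.2⟩, reportCutoff,
      M.excess_excessInv (sub_nonneg.2 (hw.myopic_le α hα)), add_sub_cancel]

lemma reportCutoff_lt_cbar (hw : M.IsBellmanSolution w) (hα : α ∈ Ico M.safeCutoff 1) :
    M.reportCutoff w α < M.cbar := by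
  have hα' : α ∈ Ioo (0 : ℝ) 1 := ⟨M.safeCutoff_pos.trans_le hα.1, hα.2⟩
  have hw₀ : M.s / M.r ≤ w α :=
    (div_le_iff₀' M.r_pos).2 ((M.safe_le_myopic α).trans (hw.myopic_le α hα'))
  calc M.reportCutoff w α = M.reportValue w α - M.loss α := hw.reportCutoff_eq_sub hα
    _ ≤ M.reportValue w α := sub_le_self _ (M.loss_nonneg α)
    _ ≤ M.lam * α * (M.g / M.r - w α) :=
        sub_le_self _ (mul_nonneg (M.scale_pos hα').le (M.valueSlope_nonneg hα' _))
    _ ≤ M.lam * α * (M.g / M.r - M.s / M.r) :=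
        mul_le_mul_of_nonneg_left (sub_le_sub_left hw₀ _) (mul_pos M.lam_pos hα'.1).le
    _ = α * (M.lam * ((M.g - M.s) / M.r)) := by ring
    _ ≤ M.lam * ((M.g - M.s) / M.r) := mul_le_of_le_one_left M.learning_pos.le hα.2.le
    _ ≤ (M.lam / M.r + 1) * (M.g - M.s) := by
        rw [mul_div_left_comm, add_mul, one_mul, mul_comm]
        exact le_add_of_nonneg_right (sub_nonneg.2 M.s_lt_g.le)
    _ < M.cbar := M.cbar_large

end IsBellmanSolution

end ReportCutoff

namespace Mechanism

variable {M : Market} (m : M.Mechanism) {α c : ℝ}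

/-- The flow of social surplus from an agent with reporting cost `c`, so that
`m.flowSurplus α = M.expect (m.surplus α)`. -/
def surplus (α c : ℝ) : ℝ :=
  m.p α c * (M.g * α) - m.p α c * m.q α c * c + (1 - m.p α c) * M.s

lemma mul_mem (hα : α ∈ Ioo (0 : ℝ) 1) (hc : c ∈ Icc 0 M.cbar) :
    m.p α c * m.q α c ∈ Icc (0 : ℝ) 1 := by
  have hp := m.p_mem α hα c hc
  have hq := m.q_mem α hα c hc
  exact ⟨mul_nonneg hp.1 hq.1, mul_le_one₀ hp.2 hq.1 hq.2⟩

lemma abs_surplus_le (hα : α ∈ Ioo (0 : ℝ) 1) (hc : c ∈ Icc 0 M.cbar) :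
    |m.surplus α c| ≤ M.g + M.cbar := by
  have hp := m.p_mem α hα c hc
  have hpq := m.mul_mem hα hc
  have hrisky := mul_nonneg hp.1 (mul_nonneg M.g_pos.le hα.1.le)
  have hrisky' := mul_le_mul_of_nonneg_left (mul_le_of_le_one_right M.g_pos.le hα.2.le) hp.1
  have hsafe := mul_nonneg (sub_nonneg.2 hp.2) M.s_pos.le
  have hsafe' := mul_le_mul_of_nonneg_left M.s_lt_g.le (sub_nonneg.2 hp.2)
  have hcost := mul_nonneg hpq.1 hc.1
  have hcost' := mul_le_of_le_one_left hc.1 hpq.2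
  rw [surplus, abs_le]
  constructor <;> linarith [hc.2, M.g_pos, hc.1]

lemma measurable_uncurry_mul : Measurable (Function.uncurry fun α c => m.p α c * m.q α c) :=
  m.p_measurable.mul m.q_measurable

lemma measurable_uncurry_surplus : Measurable (Function.uncurry m.surplus) :=
  ((m.p_measurable.mul (measurable_const.mul measurable_fst)).sub
    (m.measurable_uncurry_mul.mul measurable_snd)).add
      ((measurable_const.sub m.p_measurable).mul measurable_const)

lemma integrable_p (hα : α ∈ Ioo (0 : ℝ) 1) : Integrable (m.p α) M.costLaw :=
  M.integrable_of_abs_le (m.p_measurable.comp measurable_prodMk_left) fun c hc =>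
    (abs_of_nonneg (m.p_mem α hα c hc).1).trans_le (m.p_mem α hα c hc).2

lemma integrable_mul (hα : α ∈ Ioo (0 : ℝ) 1) :
    Integrable (fun c => m.p α c * m.q α c) M.costLaw :=
  M.integrable_of_abs_le (m.measurable_uncurry_mul.comp measurable_prodMk_left) fun _ hc =>
    (abs_of_nonneg (m.mul_mem hα hc).1).trans_le (m.mul_mem hα hc).2

lemma integrable_surplus (hα : α ∈ Ioo (0 : ℝ) 1) : Integrable (m.surplus α) M.costLaw :=
  M.integrable_of_abs_le (m.measurable_uncurry_surplus.comp measurable_prodMk_left) fun _ hc =>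
    m.abs_surplus_le hα hc

lemma flowSurplus_eq_integral : m.flowSurplus = fun α => ∫ c, m.surplus α c ∂M.costLaw :=
  funext fun _ => M.expect_eq_integral _

lemma reportProb_eq_integral :
    m.reportProb = fun α => ∫ c, m.p α c * m.q α c ∂M.costLaw :=
  funext fun _ => M.expect_eq_integral _

lemma measurable_flowSurplus : Measurable m.flowSurplus :=
  m.flowSurplus_eq_integral ▸
    m.measurable_uncurry_surplus.stronglyMeasurable.integral_prod_right.measurable

lemma measurable_reportProb : Measurable m.reportProb :=
  m.reportProb_eq_integral ▸
    m.measurable_uncurry_mul.stronglyMeasurable.integral_prod_right.measurable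

lemma abs_flowSurplus_le (hα : α ∈ Ioo (0 : ℝ) 1) : |m.flowSurplus α| ≤ M.g + M.cbar := by
  have hle : ‖∫ c, m.surplus α c ∂M.costLaw‖ ≤ _ := norm_integral_le_of_norm_le_const
    (M.ae_costLaw_mem.mono fun c hc => m.abs_surplus_le hα (Ioo_subset_Icc_self hc))
  rwa [probReal_univ, mul_one, Real.norm_eq_abs, ← congrFun m.flowSurplus_eq_integral α] at hle

lemma reportProb_mem (hα : α ∈ Ioo (0 : ℝ) 1) : m.reportProb α ∈ Icc (0 : ℝ) 1 := by
  have hmem := M.ae_costLaw_mem.mono fun c hc => m.mul_mem hα (Ioo_subset_Icc_self hc)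
  rw [reportProb_eq_integral]
  refine ⟨integral_nonneg_of_ae (hmem.mono fun c hc => hc.1), ?_⟩
  refine (integral_mono_ae (m.integrable_mul hα) (integrable_const 1)
    (hmem.mono fun c hc => hc.2)).trans_eq ?_
  rw [integral_const, probReal_univ, one_smul]

lemma flowSurplus_eq (hα : α ∈ Ioo (0 : ℝ) 1) :
    m.flowSurplus α = M.expect (m.p α) * (M.g * α) -
      M.expect (fun c => m.p α c * m.q α c * c) + (1 - M.expect (m.p α)) * M.s := by
  have hp := m.integrable_p hα
  have hcost : Integrable (fun c => m.p α c * m.q α c * c) M.costLaw :=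
    M.integrable_of_abs_le ((m.measurable_uncurry_mul.comp measurable_prodMk_left).mul
      measurable_id) fun c hc => by
        rw [abs_of_nonneg (mul_nonneg (m.mul_mem hα hc).1 hc.1)]
        exact (mul_le_of_le_one_left hc.1 (m.mul_mem hα hc).2).trans hc.2
  have hsum : m.flowSurplus α + M.expect (fun c => m.p α c * m.q α c * c) =
      M.expect fun c => m.p α c * (M.g * α - M.s) + M.s := by
    simp only [flowSurplus_eq_integral, expect_eq_integral]
    rw [← integral_add (m.integrable_surplus hα) hcost]
    congr 1 with c
    rw [surplus]
    ring
  rw [M.expect_eq_integral fun c => m.p α c * (M.g * α - M.s) + M.s,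
    integral_add (hp.mul_const _) (integrable_const _), integral_mul_const, integral_const,
    probReal_univ, one_smul, ← M.expect_eq_integral] at hsum
  linarith

lemma flowSurplus_add_reportProb_mul (hα : α ∈ Ioo (0 : ℝ) 1) (b : ℝ) :
    m.flowSurplus α + m.reportProb α * b =
      ∫ c, m.surplus α c + m.p α c * m.q α c * b ∂M.costLaw := by
  rw [integral_add (m.integrable_surplus hα) ((m.integrable_mul hα).mul_const b),
    integral_mul_const, flowSurplus_eq_integral, reportProb_eq_integral]

lemma surplus_add_mul_le (hα : α ∈ Ioo (0 : ℝ) 1) (hc : c ∈ Icc 0 M.cbar) (b : ℝ) :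
    m.surplus α c + m.p α c * m.q α c * b ≤ M.myopic α + max (b - M.loss α - c) 0 := by
  have hp := m.p_mem α hα c hc
  have hpq := m.mul_mem hα hc
  have hsafe := mul_le_mul_of_nonneg_left (M.safe_le_myopic α) (sub_nonneg.2 hp.2)
  have hloss := mul_le_mul_of_nonneg_right
    (mul_le_of_le_one_right hp.1 (m.q_mem α hα c hc).2) (M.loss_nonneg α)
  calc m.surplus α c + m.p α c * m.q α c * b
      ≤ M.myopic α + m.p α c * m.q α c * (b - M.loss α - c) := by
        simp only [surplus, loss] at hloss ⊢
        linarith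
    _ ≤ M.myopic α + m.p α c * m.q α c * max (b - M.loss α - c) 0 := by
        gcongr
        exacts [hpq.1, le_max_left _ _]
    _ ≤ M.myopic α + max (b - M.loss α - c) 0 := by
        gcongr
        exact mul_le_of_le_one_left (le_max_right _ _) hpq.2

end Mechanism

lemma add_excess_eq_integral (M : Market) (y b : ℝ) :
    y + M.excess b = ∫ c, y + max (b - c) 0 ∂M.costLaw := by
  rw [integral_add (integrable_const y) (integrable_max_sub_zero M.integrable_cost b),
    integral_const, probReal_univ, one_smul, excess, expectedExcess]

lemma Mechanism.flowSurplus_add_le {M : Market} (m : M.Mechanism) {α : ℝ}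
    (hα : α ∈ Ioo (0 : ℝ) 1) (b : ℝ) :
    m.flowSurplus α + m.reportProb α * b ≤ M.myopic α + M.excess (b - M.loss α) := by
  rw [m.flowSurplus_add_reportProb_mul hα, add_excess_eq_integral]
  exact integral_mono_ae ((m.integrable_surplus hα).add ((m.integrable_mul hα).mul_const b))
    ((integrable_const _).add (integrable_max_sub_zero M.integrable_cost _))
    (M.ae_costLaw_mem.mono fun c hc => m.surplus_add_mul_le hα (Ioo_subset_Icc_self hc) b)

section CutoffMechanism

variable {M : Market} {C : ℝ → ℝ} (hC : Measurable C) {α c : ℝ}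

/-- The mechanism that collects a report exactly from the agents whose cost is below the cutoff
`C α`, paying them `C α` and the loss from consuming the risky product, and allocates the
myopically better product to the others. Where the latter is the safe product, the value of `q`
for these agents is irrelevant; it is `1` above `safeCutoff`. -/
def cutoffMechanism (M : Market) (hC : Measurable C) : M.Mechanism where
  p α c := if c < C α ∨ M.s ≤ M.g * α then 1 else 0
  q α c := if c < C α ∨ M.safeCutoff < α ∧ M.g * α < M.s then 1 else 0
  t α c := if c < C α then -(C α + M.loss α) else 0
  p_measurable := Measurable.ite
    ((measurableSet_lt measurable_snd (hC.comp measurable_fst)).union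
      (measurableSet_le measurable_const (measurable_fst.const_mul _)))
    measurable_const measurable_const
  q_measurable := Measurable.ite
    ((measurableSet_lt measurable_snd (hC.comp measurable_fst)).union
      ((measurableSet_lt measurable_const measurable_fst).inter
        (measurableSet_lt (measurable_fst.const_mul _) measurable_const)))
    measurable_const measurable_const
  t_measurable := Measurable.ite (measurableSet_lt measurable_snd (hC.comp measurable_fst))
    ((hC.add (M.continuous_myopic.measurable.sub (measurable_id.const_mul _))).comp
      measurable_fst).neg measurable_const
  p_mem _ _ _ _ := by split_ifs <;> simp
  q_mem _ _ _ _ := by split_ifs <;> simp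

lemma cutoffMechanism_mul (M : Market) :
    (M.cutoffMechanism hC).p α c * (M.cutoffMechanism hC).q α c = if c < C α then 1 else 0 := by
  simp only [cutoffMechanism]
  grind

lemma surplus_cutoffMechanism :
    (M.cutoffMechanism hC).surplus α c =
      M.myopic α - if c < C α then M.loss α + c else 0 := by
  rw [Mechanism.surplus, cutoffMechanism_mul]
  simp only [cutoffMechanism, loss, myopic]
  grind

lemma agentUtility_cutoffMechanism (c c' : ℝ) :
    (M.cutoffMechanism hC).agentUtility c c' α =
      M.myopic α + if c' < C α then C α - c else 0 := by
  simp only [Mechanism.agentUtility, cutoffMechanism, loss, myopic, g]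
  grind

lemma incentiveCompatible_cutoffMechanism : (M.cutoffMechanism hC).IncentiveCompatible := by
  intro α _ c _ c' _
  rw [agentUtility_cutoffMechanism, agentUtility_cutoffMechanism]
  split_ifs <;> linarith

lemma reportProb_cutoffMechanism (M : Market) :
    (M.cutoffMechanism hC).reportProb = fun α => M.costLaw.real (Iio (C α)) := by
  funext α
  simp only [Mechanism.reportProb_eq_integral, cutoffMechanism_mul]
  exact (integral_indicator_Iio_const _ _).trans (mul_one _)

lemma flowSurplus_cutoffMechanism_add (hα : α ∈ Ioo (0 : ℝ) 1) {b : ℝ}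
    (hCb : C α = max (b - M.loss α) 0) :
    (M.cutoffMechanism hC).flowSurplus α + (M.cutoffMechanism hC).reportProb α * b =
      M.myopic α + M.excess (b - M.loss α) := by
  rw [Mechanism.flowSurplus_add_reportProb_mul _ hα, add_excess_eq_integral]
  refine integral_congr_ae (M.ae_costLaw_nonneg.mono fun c hc => ?_)
  simp only [surplus_cutoffMechanism, cutoffMechanism_mul, hCb]
  grind

end CutoffMechanism

section Posterior

variable (M : Market) (α₀ : ℝ)

/-- The no-news belief after the amount `x` of reported experimentation. -/
def posterior (x : ℝ) : ℝ :=
  Real.sigmoid (logit α₀ - M.lam * x)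

/-- The probability of no good news during the amount `x` of reported experimentation. -/
def noNews (x : ℝ) : ℝ :=
  α₀ * Real.exp (-(M.lam * x)) + (1 - α₀)

lemma posterior_mem (x : ℝ) : M.posterior α₀ x ∈ Ioo (0 : ℝ) 1 :=
  sigmoid_mem_Ioo _

lemma continuous_posterior : Continuous (M.posterior α₀) :=
  continuous_sigmoid.comp (by fun_prop)

lemma continuous_noNews : Continuous (M.noNews α₀) := by
  unfold noNews
  fun_prop

variable {α₀} (hα₀ : α₀ ∈ Ioo (0 : ℝ) 1)
include hα₀

lemma noNews_pos (x : ℝ) : 0 < M.noNews α₀ x :=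
  add_pos (mul_pos hα₀.1 (Real.exp_pos _)) (sub_pos.2 hα₀.2)

lemma noNews_le_one {x : ℝ} (hx : 0 ≤ x) : M.noNews α₀ x ≤ 1 := by
  have h := mul_le_of_le_one_right hα₀.1.le
    (Real.exp_le_one_iff.2 (neg_nonpos.2 (mul_nonneg M.lam_pos.le hx)))
  rw [noNews]
  linarith

lemma exp_div_noNews (x : ℝ) :
    α₀ * Real.exp (-(M.lam * x)) / M.noNews α₀ x = M.posterior α₀ x := by
  have h₀ := hα₀.1.ne'
  have hN := M.noNews_pos hα₀ x
  rw [noNews, Real.exp_neg] at hN ⊢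
  rw [posterior, Real.sigmoid_def, neg_sub, Real.exp_sub, exp_logit hα₀]
  field_simp

lemma noNews_mul_posterior (x : ℝ) :
    M.noNews α₀ x * M.posterior α₀ x = α₀ * Real.exp (-(M.lam * x)) := by
  rw [← M.exp_div_noNews hα₀, mul_div_cancel₀ _ (M.noNews_pos hα₀ x).ne']

lemma noNews_eq_div (x : ℝ) : M.noNews α₀ x = (1 - α₀) / (1 - M.posterior α₀ x) := by
  rw [eq_div_iff (sub_pos.2 (M.posterior_mem α₀ x).2).ne', mul_sub, M.noNews_mul_posterior hα₀,
    noNews]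
  ring

lemma posterior_zero : M.posterior α₀ 0 = α₀ := by
  rw [posterior, mul_zero, sub_zero, sigmoid_logit hα₀]

omit hα₀ in
lemma hasDerivAt_posterior (x : ℝ) :
    HasDerivAt (M.posterior α₀)
      (-(M.lam * (M.posterior α₀ x * (1 - M.posterior α₀ x)))) x := by
  refine ((Real.hasDerivAt_sigmoid _).comp x
    (((hasDerivAt_id x).const_mul M.lam).const_sub (logit α₀))).congr_deriv ?_
  simp only [posterior, id]
  ring

lemma hasDerivAt_noNews (x : ℝ) :
    HasDerivAt (M.noNews α₀) (-(M.lam * (M.noNews α₀ x * M.posterior α₀ x))) x := by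
  rw [M.noNews_mul_posterior hα₀]
  refine (((((hasDerivAt_id x).const_mul M.lam).neg.exp).const_mul α₀).add_const _).congr_deriv ?_
  simp only [id, Pi.neg_apply]
  ring

end Posterior

namespace Mechanism

namespace IsBeliefPath

variable {M : Market} {m : M.Mechanism} {α₀ τ : ℝ} {a : ℝ → ℝ}

lemma eq_posterior (ha : m.IsBeliefPath α₀ a) (hα₀ : α₀ ∈ Ioo (0 : ℝ) 1) (hτ : 0 ≤ τ) :
    a τ = M.posterior α₀ (m.experience a τ) :=
  (ha.bayes τ hτ).trans (M.exp_div_noNews hα₀ _)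

lemma mem_Ioo (ha : m.IsBeliefPath α₀ a) (hα₀ : α₀ ∈ Ioo (0 : ℝ) 1) (hτ : 0 ≤ τ) :
    a τ ∈ Ioo (0 : ℝ) 1 :=
  ha.eq_posterior hα₀ hτ ▸ M.posterior_mem _ _

lemma abs_reportProb_le (ha : m.IsBeliefPath α₀ a) (hα₀ : α₀ ∈ Ioo (0 : ℝ) 1) (hτ : 0 ≤ τ) :
    |m.reportProb (a τ)| ≤ 1 := by
  have hx := m.reportProb_mem (ha.mem_Ioo hα₀ hτ)
  rw [abs_of_nonneg hx.1]
  exact hx.2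

lemma aemeasurable (ha : m.IsBeliefPath α₀ a) : AEMeasurable a (volume.restrict (Ioi 0)) :=
  (ha.continuousOn.mono Ioi_subset_Ici_self).aemeasurable measurableSet_Ioi

lemma intervalIntegrable_reportProb (ha : m.IsBeliefPath α₀ a) (hα₀ : α₀ ∈ Ioo (0 : ℝ) 1)
    (hτ : 0 ≤ τ) : IntervalIntegrable (fun u => m.reportProb (a u)) volume 0 τ := by
  have hmeas := m.measurable_reportProb.comp_aemeasurable
    (ha.aemeasurable.mono_set (Ioc_subset_Ioi_self : Ioc 0 τ ⊆ Ioi 0))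
  exact (intervalIntegrable_iff_integrableOn_Ioc_of_le hτ).2 <|
    (integrable_const (1 : ℝ)).mono' hmeas.aestronglyMeasurable
      ((ae_restrict_iff' measurableSet_Ioc).2
        (ae_of_all _ fun u hu => ha.abs_reportProb_le hα₀ hu.1.le))

lemma experience_nonneg (ha : m.IsBeliefPath α₀ a) (hα₀ : α₀ ∈ Ioo (0 : ℝ) 1) (hτ : 0 ≤ τ) :
    0 ≤ m.experience a τ :=
  intervalIntegral.integral_nonneg hτ fun _ hu => (m.reportProb_mem (ha.mem_Ioo hα₀ hu.1)).1

lemma noNewsProb_mem (ha : m.IsBeliefPath α₀ a) (hα₀ : α₀ ∈ Ioo (0 : ℝ) 1) (hτ : 0 ≤ τ) :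
    m.noNewsProb α₀ a τ ∈ Ioc (0 : ℝ) 1 :=
  ⟨M.noNews_pos hα₀ _, M.noNews_le_one hα₀ (ha.experience_nonneg hα₀ hτ)⟩

lemma noNewsProb_eq_div (ha : m.IsBeliefPath α₀ a) (hα₀ : α₀ ∈ Ioo (0 : ℝ) 1) (hτ : 0 ≤ τ) :
    m.noNewsProb α₀ a τ = (1 - α₀) / (1 - a τ) := by
  rw [ha.eq_posterior hα₀ hτ]
  exact M.noNews_eq_div hα₀ _

lemma aemeasurable_noNewsProb (ha : m.IsBeliefPath α₀ a) (hα₀ : α₀ ∈ Ioo (0 : ℝ) 1) :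
    AEMeasurable (m.noNewsProb α₀ a) (volume.restrict (Ioi 0)) :=
  ((ha.aemeasurable.const_sub 1).const_div (1 - α₀)).congr <|
    (ae_restrict_iff' measurableSet_Ioi).2 <| ae_of_all _ fun _ hu =>
      (ha.noNewsProb_eq_div hα₀ (le_of_lt hu)).symm

end IsBeliefPath

/-- The rate at which discounted social surplus accrues along the belief path `a`. -/
def welfareRate {M : Market} (m : M.Mechanism) (α₀ : ℝ) (a : ℝ → ℝ) (τ : ℝ) : ℝ :=
  Real.exp (-(M.r * τ)) * m.noNewsProb α₀ a τ *
    (m.flowSurplus (a τ) + M.lam * a τ * m.reportProb (a τ) * (M.g / M.r))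

variable {M : Market} {m : M.Mechanism} {α₀ τ : ℝ} {a : ℝ → ℝ}

lemma IsBeliefPath.abs_welfareRate_le (ha : m.IsBeliefPath α₀ a) (hα₀ : α₀ ∈ Ioo (0 : ℝ) 1)
    (hτ : 0 ≤ τ) :
    |m.welfareRate α₀ a τ| ≤
      (M.g + M.cbar + M.lam * (M.g / M.r)) * Real.exp (-(M.r * τ)) := by
  have hα := ha.mem_Ioo hα₀ hτ
  have hS := ha.noNewsProb_mem hα₀ hτ
  have hg := div_pos M.g_pos M.r_pos
  rw [welfareRate, mul_assoc, abs_mul, abs_mul, Real.abs_exp, abs_of_pos hS.1, mul_comm _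
    (Real.exp _)]
  refine mul_le_mul_of_nonneg_left
    ((mul_le_of_le_one_left (abs_nonneg _) hS.2).trans ((abs_add_le _ _).trans
      (add_le_add (m.abs_flowSurplus_le hα) ?_))) (Real.exp_pos _).le
  rw [mul_assoc, mul_assoc, abs_mul, abs_mul, abs_mul, abs_of_pos M.lam_pos, abs_of_pos hα.1,
    abs_of_pos hg]
  refine mul_le_mul_of_nonneg_left ?_ M.lam_pos.le
  exact (mul_le_of_le_one_left (by positivity) hα.2.le).trans
    (mul_le_of_le_one_left hg.le (ha.abs_reportProb_le hα₀ hτ))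

lemma IsBeliefPath.integrableOn_welfareRate (ha : m.IsBeliefPath α₀ a)
    (hα₀ : α₀ ∈ Ioo (0 : ℝ) 1) : IntegrableOn (m.welfareRate α₀ a) (Ioi 0) := by
  have hexp : IntegrableOn (fun τ => Real.exp (-(M.r * τ))) (Ioi 0) := by
    simpa only [neg_mul] using exp_neg_integrableOn_Ioi 0 M.r_pos
  refine (hexp.const_mul (M.g + M.cbar + M.lam * (M.g / M.r))).mono' ?_ ?_
  · have hmeas := ha.aemeasurable
    have hflow := m.measurable_flowSurplus.comp_aemeasurable hmeas
    have hprob := m.measurable_reportProb.comp_aemeasurable hmeas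
    exact (((Measurable.aemeasurable (by fun_prop)).mul (ha.aemeasurable_noNewsProb hα₀)).mul
      (hflow.add (((hmeas.const_mul _).mul hprob).mul_const _))).aestronglyMeasurable
  · exact (ae_restrict_iff' measurableSet_Ioi).2
      (ae_of_all _ fun τ hτ => ha.abs_welfareRate_le hα₀ (le_of_lt hτ))

lemma IsBeliefPath.tendsto_integral_welfareRate (ha : m.IsBeliefPath α₀ a)
    (hα₀ : α₀ ∈ Ioo (0 : ℝ) 1) :
    Tendsto (fun T => ∫ τ in (0 : ℝ)..T, m.welfareRate α₀ a τ) atTop (𝓝 (m.welfare α₀ a)) :=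
  intervalIntegral_tendsto_integral_Ioi 0 (ha.integrableOn_welfareRate hα₀) tendsto_id

/-- In terms of the amount `X` of reported experimentation, the belief dynamics is an autonomous
equation with a bounded continuous right-hand side. -/
lemma exists_isBeliefPath (hm : ContinuousOn m.reportProb (Ioo 0 1))
    (hα₀ : α₀ ∈ Ioo (0 : ℝ) 1) : ∃ a, m.IsBeliefPath α₀ a := by
  let F : ℝ → ℝ := fun x => m.reportProb (M.posterior α₀ x)
  have hF : Continuous F :=
    hm.comp_continuous (M.continuous_posterior α₀) (M.posterior_mem α₀)
  have hbound : ∀ _t x : ℝ, |F x| ≤ (1 : NNReal) := fun _ x => by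
    have hx := m.reportProb_mem (M.posterior_mem α₀ x)
    rw [abs_of_nonneg hx.1]
    exact hx.2
  obtain ⟨X, hX₀, hX⟩ :=
    exists_hasDerivAt_of_continuous_of_bounded (hF.comp continuous_snd) hbound 0 0
  have hXc : Continuous X := continuous_iff_continuousAt.2 fun t => (hX t).continuousAt
  have hexp : ∀ τ, m.experience (M.posterior α₀ ∘ X) τ = X τ := fun τ => by
    rw [← sub_zero (X τ), ← hX₀]
    exact intervalIntegral.integral_eq_sub_of_hasDerivAt (fun t _ => hX t)
      ((hF.comp hXc).intervalIntegrable _ _)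
  refine ⟨M.posterior α₀ ∘ X, ((M.continuous_posterior α₀).comp hXc).continuousOn,
    fun τ _ => ?_⟩
  rw [noNewsProb, hexp]
  exact (M.exp_div_noNews hα₀ _).symm

end Mechanism

section Verification

variable {M : Market} {w : ℝ → ℝ} {α α₀ : ℝ}

namespace IsBellmanSolution

lemma continuousOn_reportValue (hw : M.IsBellmanSolution w) :
    ContinuousOn (M.reportValue w) (Ioo 0 1) := by
  have hwc := hw.continuousOn
  have hdrift : ContinuousOn (fun α => max 0 (M.valueDrift α (w α))) (Ioo 0 1) :=
    (continuous_const.max M.continuous_valueDrift).comp_continuousOn (continuousOn_id.prodMk hwc)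
  exact (show ContinuousOn (fun α => M.lam * α * (M.g / M.r - w α) -
    max 0 (M.valueDrift α (w α))) (Ioo 0 1) by fun_prop).congr fun α hα => by
      rw [reportValue, M.scale_mul_valueSlope hα]

end IsBellmanSolution

/-- The value of continuing after the amount `x` of reported experimentation, weighted by the
probability of no good news. -/
def weightedValue (M : Market) (w : ℝ → ℝ) (α₀ x : ℝ) : ℝ :=
  M.noNews α₀ x * w (M.posterior α₀ x)

namespace IsBellmanSolution

lemma hasDerivAt_weightedValue (hw : M.IsBellmanSolution w) (hα₀ : α₀ ∈ Ioo (0 : ℝ) 1) (x : ℝ) :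
    HasDerivAt (M.weightedValue w α₀) (M.noNews α₀ x *
      (M.reportValue w (M.posterior α₀ x) - M.lam * M.posterior α₀ x * (M.g / M.r))) x := by
  refine ((M.hasDerivAt_noNews hα₀ x).mul ((hw.hasDerivAt _ (M.posterior_mem α₀ x)).comp x
    (M.hasDerivAt_posterior x))).congr_deriv ?_
  simp only [reportValue, Function.comp_apply]
  ring

lemma contDiff_weightedValue (hw : M.IsBellmanSolution w) (hα₀ : α₀ ∈ Ioo (0 : ℝ) 1) :
    ContDiff ℝ 1 (M.weightedValue w α₀) := by
  have hP := M.continuous_posterior α₀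
  have hN := M.continuous_noNews α₀
  have hV := hw.continuousOn_reportValue.comp_continuous hP (M.posterior_mem α₀)
  have hderiv := hw.hasDerivAt_weightedValue hα₀
  refine contDiff_one_iff_deriv.2 ⟨fun x => (hderiv x).differentiableAt, ?_⟩
  rw [funext fun x => (hderiv x).deriv]
  fun_prop

end IsBellmanSolution

open Mechanism

variable {m : M.Mechanism} {a : ℝ → ℝ} {τ T : ℝ}

/-- The rate at which the discounted, weighted value falls along the belief path `a`, when the
value function is `w`. -/
def valueRate (m : M.Mechanism) (w : ℝ → ℝ) (α₀ : ℝ) (a : ℝ → ℝ) (τ : ℝ) : ℝ :=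
  Real.exp (-(M.r * τ)) * m.noNewsProb α₀ a τ * (M.r * w (a τ) -
    m.reportProb (a τ) * (M.reportValue w (a τ) - M.lam * a τ * (M.g / M.r)))

lemma valueRate_sub_welfareRate :
    valueRate m w α₀ a τ - m.welfareRate α₀ a τ = Real.exp (-(M.r * τ)) * m.noNewsProb α₀ a τ *
      (M.r * w (a τ) - (m.flowSurplus (a τ) + m.reportProb (a τ) * M.reportValue w (a τ))) := by
  rw [valueRate, welfareRate]
  ring

namespace IsBellmanSolution

lemma flowSurplus_add_le (hw : M.IsBellmanSolution w) (m : M.Mechanism)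
    (hα : α ∈ Ioo (0 : ℝ) 1) :
    m.flowSurplus α + m.reportProb α * M.reportValue w α ≤ M.r * w α :=
  (m.flowSurplus_add_le hα _).trans_eq (hw.myopic_add_excess hα)

lemma welfareRate_le_valueRate (hw : M.IsBellmanSolution w) (ha : m.IsBeliefPath α₀ a)
    (hα₀ : α₀ ∈ Ioo (0 : ℝ) 1) (hτ : 0 ≤ τ) :
    m.welfareRate α₀ a τ ≤ valueRate m w α₀ a τ := by
  rw [← sub_nonneg, valueRate_sub_welfareRate]
  exact mul_nonneg (mul_nonneg (Real.exp_pos _).le (ha.noNewsProb_mem hα₀ hτ).1.le)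
    (sub_nonneg.2 (hw.flowSurplus_add_le m (ha.mem_Ioo hα₀ hτ)))

/-- The fundamental theorem of calculus holds although `reportProb` is only measurable in the
belief: the value is continuously differentiable in the amount of experimentation, which is
Lipschitz in time. -/
lemma integral_valueRate (hw : M.IsBellmanSolution w) (ha : m.IsBeliefPath α₀ a)
    (hα₀ : α₀ ∈ Ioo (0 : ℝ) 1) (hT : 0 ≤ T) :
    IntervalIntegrable (valueRate m w α₀ a) volume 0 T ∧
      ∫ τ in (0 : ℝ)..T, valueRate m w α₀ a τ =
        w α₀ - Real.exp (-(M.r * T)) * (m.noNewsProb α₀ a T * w (a T)) := by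
  have hx := ha.intervalIntegrable_reportProb hα₀ hT
  have hmem : ∀ u ∈ uIcc 0 T, 0 ≤ u := fun u hu => (uIcc_of_le hT ▸ hu).1
  have hlip : LipschitzOnWith 1 (m.experience a) (uIcc 0 T) :=
    lipschitzOnWith_integral hx fun u hu => ha.abs_reportProb_le hα₀ (hmem u hu)
  have hac : AbsolutelyContinuousOnInterval
      (fun τ => -Real.exp (-(M.r * τ)) * M.weightedValue w α₀ (m.experience a τ)) 0 T :=
    (ContDiff.contDiffOn (by fun_prop)).absolutelyContinuousOnInterval.mul
      (absolutelyContinuousOnInterval_comp_of_lipschitzOnWith (hw.contDiff_weightedValue hα₀) hlip)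
  have hderiv : ∀ᵐ τ, τ ∈ uIcc 0 T → HasDerivAt
      (fun τ => -Real.exp (-(M.r * τ)) * M.weightedValue w α₀ (m.experience a τ))
      (valueRate m w α₀ a τ) τ := by
    filter_upwards [hx.ae_hasDerivAt_integral] with τ hX hτ
    refine ((((hasDerivAt_id τ).const_mul M.r).neg.exp.neg).mul
      ((hw.hasDerivAt_weightedValue hα₀ _).comp τ (hX hτ 0 left_mem_uIcc))).congr_deriv ?_
    simp only [valueRate, ha.eq_posterior hα₀ (hmem τ hτ), noNewsProb, experience, weightedValue,
      noNews, Function.comp_apply, Pi.neg_apply, id]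
    ring
  obtain ⟨hint, hftc⟩ := intervalIntegrable_and_integral_eq_sub_of_ae_hasDerivAt hac hderiv
  refine ⟨hint, hftc.trans ?_⟩
  have h₀ : m.experience a 0 = 0 := intervalIntegral.integral_same
  rw [h₀, weightedValue, weightedValue, ← ha.eq_posterior hα₀ hT, M.posterior_zero hα₀]
  simp only [noNewsProb, noNews, mul_zero, neg_zero, Real.exp_zero]
  ring

lemma tendsto_integral_valueRate (hw : M.IsBellmanSolution w) (ha : m.IsBeliefPath α₀ a)
    (hα₀ : α₀ ∈ Ioo (0 : ℝ) 1) :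
    Tendsto (fun T => ∫ τ in (0 : ℝ)..T, valueRate m w α₀ a τ) atTop (𝓝 (w α₀)) := by
  have hexp : Tendsto (fun T => Real.exp (-(M.r * T))) atTop (𝓝 0) :=
    Real.tendsto_exp_neg_atTop_nhds_zero.comp (tendsto_id.const_mul_atTop M.r_pos)
  have hbdd : ∀ᶠ T in atTop, |m.noNewsProb α₀ a T * w (a T)| ≤ M.g / M.r := by
    filter_upwards [eventually_ge_atTop 0] with T hT
    have hα := ha.mem_Ioo hα₀ hT
    have hS := ha.noNewsProb_mem hα₀ hT
    have hw₀ : 0 ≤ w (a T) := nonneg_of_mul_nonneg_right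
      (M.s_pos.le.trans ((M.safe_le_myopic _).trans (hw.myopic_le _ hα))) M.r_pos
    rw [abs_of_nonneg (mul_nonneg hS.1.le hw₀)]
    exact (mul_le_of_le_one_left hw₀ hS.2).trans (hw.le_risky hα)
  have hlim := (tendsto_const_nhds (x := w α₀)).sub
    (hexp.zero_mul_isBoundedUnder_le (isBoundedUnder_of_eventually_le hbdd))
  rw [sub_zero] at hlim
  exact hlim.congr' <| (eventually_ge_atTop 0).mono fun T hT =>
    (hw.integral_valueRate ha hα₀ hT).2.symm

theorem welfare_le (hw : M.IsBellmanSolution w) (ha : m.IsBeliefPath α₀ a)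
    (hα₀ : α₀ ∈ Ioo (0 : ℝ) 1) : m.welfare α₀ a ≤ w α₀ := by
  refine le_of_tendsto_of_tendsto (ha.tendsto_integral_welfareRate hα₀)
    (hw.tendsto_integral_valueRate ha hα₀) ?_
  filter_upwards [eventually_ge_atTop 0] with T hT
  exact intervalIntegral.integral_mono_on hT
    ((intervalIntegrable_iff_integrableOn_Ioc_of_le hT).2
      ((ha.integrableOn_welfareRate hα₀).mono_set Ioc_subset_Ioi_self))
    (hw.integral_valueRate ha hα₀ hT).1
    fun τ hτ => hw.welfareRate_le_valueRate ha hα₀ hτ.1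

theorem welfare_eq (hw : M.IsBellmanSolution w) (ha : m.IsBeliefPath α₀ a)
    (hα₀ : α₀ ∈ Ioo (0 : ℝ) 1) (hm : ∀ α ∈ Ioo (0 : ℝ) 1,
      m.flowSurplus α + m.reportProb α * M.reportValue w α = M.r * w α) :
    m.welfare α₀ a = w α₀ := by
  refine tendsto_nhds_unique (ha.tendsto_integral_welfareRate hα₀)
    ((hw.tendsto_integral_valueRate ha hα₀).congr' ?_)
  filter_upwards [eventually_ge_atTop 0] with T hT
  refine intervalIntegral.integral_congr fun τ hτ => sub_eq_zero.1 ?_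
  rw [valueRate_sub_welfareRate, hm _ (ha.mem_Ioo hα₀ (uIcc_of_le hT ▸ hτ).1), sub_self, mul_zero]

end IsBellmanSolution

end Verification

section Regimes

variable {M : Market} {C : ℝ → ℝ} (hC : Measurable C) {α c : ℝ}

lemma cutoffMechanism_of_le_safeCutoff (hα : α ≤ M.safeCutoff) (hc : C α ≤ c) :
    (M.cutoffMechanism hC).p α c = 0 ∧ (M.cutoffMechanism hC).q α c = 0 := by
  have hg := (mul_le_mul_of_nonneg_left hα M.g_pos.le).trans_lt
    ((lt_div_iff₀' M.g_pos).1 M.safeCutoff_lt)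
  simp only [cutoffMechanism, hc.not_gt, hg.not_ge, hα.not_gt, false_and, or_self, if_false,
    and_self]

lemma cutoffMechanism_of_risky_lt (hα : M.safeCutoff < α) (hg : M.g * α < M.s) (c : ℝ) :
    (M.cutoffMechanism hC).q α c = 1 ∧
      (M.cutoffMechanism hC).p α c = if c < C α then 1 else 0 := by
  simp only [cutoffMechanism, hα, hg, hg.not_ge, and_self, or_true, or_false, if_true]

lemma cutoffMechanism_of_safe_le (hg : M.s ≤ M.g * α) (c : ℝ) :
    (M.cutoffMechanism hC).p α c = 1 ∧
      (M.cutoffMechanism hC).q α c = if c < C α then 1 else 0 := by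
  simp only [cutoffMechanism, hg, hg.not_gt, and_false, or_true, or_false, if_true, and_self]

end Regimes

namespace IsBellmanSolution

variable {M : Market} {w : ℝ → ℝ} {α α₀ : ℝ}

/-- The mechanism that collects the reports whose cost is below the marginal value of reports; it
turns out to be optimal. -/
def mechanism (hw : M.IsBellmanSolution w) : M.Mechanism :=
  M.cutoffMechanism hw.measurable_reportCutoff

lemma bellman_mechanism (hw : M.IsBellmanSolution w) (hα : α ∈ Ioo (0 : ℝ) 1) :
    hw.mechanism.flowSurplus α + hw.mechanism.reportProb α * M.reportValue w α = M.r * w α :=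
  (flowSurplus_cutoffMechanism_add _ hα (hw.reportCutoff_eq_max hα)).trans
    (hw.myopic_add_excess hα)

lemma welfare_mechanism (hw : M.IsBellmanSolution w) (hα₀ : α₀ ∈ Ioo (0 : ℝ) 1) {a : ℝ → ℝ}
    (ha : hw.mechanism.IsBeliefPath α₀ a) : hw.mechanism.welfare α₀ a = w α₀ :=
  hw.welfare_eq ha hα₀ fun _ => hw.bellman_mechanism

theorem isOptimal_mechanism (hw : M.IsBellmanSolution w) : hw.mechanism.IsOptimal := by
  intro α₀ hα₀
  have hprob : ContinuousOn hw.mechanism.reportProb (Ioo 0 1) := by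
    rw [mechanism, reportProb_cutoffMechanism]
    exact M.continuous_real_Iio_costLaw.comp_continuousOn hw.continuousOn_reportCutoff
  refine ⟨Mechanism.exists_isBeliefPath hprob hα₀, fun a ha => ⟨⟨_, a, ha, rfl⟩, ?_⟩⟩
  rintro _ ⟨n, b, hb, rfl⟩
  exact (hw.welfare_le hb hα₀).trans_eq (hw.welfare_mechanism hα₀ ha).symm

lemma W_eq (hw : M.IsBellmanSolution w) (hα : α ∈ Ioo (0 : ℝ) 1) : M.W α = w α := by
  obtain ⟨⟨a, ha⟩, hgreatest⟩ := hw.isOptimal_mechanism α hα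
  rw [W, (hgreatest a ha).csSup_eq, hw.welfare_mechanism hα ha]

lemma hasDerivAt_W (hw : M.IsBellmanSolution w) (hα : α ∈ Ioo (0 : ℝ) 1) :
    HasDerivAt M.W (M.valueSlope α (w α)) α :=
  (hw.hasDerivAt α hα).congr_of_eventuallyEq <|
    eventually_of_mem (Ioo_mem_nhds hα.1 hα.2) fun _ => hw.W_eq

lemma B_eq (hw : M.IsBellmanSolution w) (hα : α ∈ Ioo (0 : ℝ) 1) :
    M.B α = M.reportValue w α := by
  rw [B, hw.W_eq hα, (hw.hasDerivAt_W hα).deriv, reportValue, g]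
  ring

lemma mul_W_eq (hw : M.IsBellmanSolution w) (hα : α ∈ Ioo (0 : ℝ) 1) :
    M.r * M.W α =
      hw.mechanism.flowSurplus α + hw.mechanism.reportProb α * M.B α := by
  rw [hw.W_eq hα, hw.B_eq hα, hw.bellman_mechanism hα]

lemma reportCutoff_eq_C₁ (hw : M.IsBellmanSolution w) (hα : α ∈ Ico M.safeCutoff 1)
    (hg : M.g * α ≤ M.s) : M.reportCutoff w α = M.C₁ α := by
  rw [hw.reportCutoff_eq_sub hα, C₁, hw.B_eq ⟨M.safeCutoff_pos.trans_le hα.1, hα.2⟩, loss,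
    M.myopic_eq_safe hg, g]
  ring

lemma reportCutoff_eq_C₂ (hw : M.IsBellmanSolution w) (hα : α ∈ Ico M.safeCutoff 1)
    (hg : M.s ≤ M.g * α) : M.reportCutoff w α = M.C₂ α := by
  rw [hw.reportCutoff_eq_sub hα, C₂, hw.B_eq ⟨M.safeCutoff_pos.trans_le hα.1, hα.2⟩, loss,
    M.myopic_eq_risky hg, sub_self, sub_zero]

lemma safe_arm (hw : M.IsBellmanSolution w) (hα : α ∈ Ioc 0 M.safeCutoff) {c : ℝ} (hc : 0 ≤ c) :
    hw.mechanism.p α c = 0 ∧ hw.mechanism.q α c = 0 :=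
  cutoffMechanism_of_le_safeCutoff _ hα.2 ((hw.reportCutoff_eq_zero hα).trans_le hc)

lemma partial_coverage (hw : M.IsBellmanSolution w) (hα : α ∈ Ioo M.safeCutoff (M.s / M.g))
    (hval : M.myopic α < M.r * w α) :
    0 < M.C₁ α ∧ M.C₁ α < M.cbar ∧ ∀ c, hw.mechanism.q α c = 1 ∧
      hw.mechanism.p α c = if c < M.C₁ α then 1 else 0 := by
  have hα' : α ∈ Ico M.safeCutoff 1 := ⟨hα.1.le, hα.2.trans M.safe_div_g_lt_one⟩
  have hg : M.g * α < M.s := (lt_div_iff₀' M.g_pos).1 hα.2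
  rw [← hw.reportCutoff_eq_C₁ hα' hg.le]
  exact ⟨M.excessInv_pos (sub_pos.2 hval), hw.reportCutoff_lt_cbar hα',
    cutoffMechanism_of_risky_lt _ hα.1 hg⟩

lemma full_coverage (hw : M.IsBellmanSolution w) (hα : α ∈ Ico (M.s / M.g) 1)
    (hval : M.myopic α < M.r * w α) :
    0 < M.C₂ α ∧ M.C₂ α < M.cbar ∧ ∀ c, hw.mechanism.p α c = 1 ∧
      hw.mechanism.q α c = if c < M.C₂ α then 1 else 0 := by
  have hα' : α ∈ Ico M.safeCutoff 1 := ⟨M.safeCutoff_lt.le.trans hα.1, hα.2⟩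
  have hg : M.s ≤ M.g * α := (div_le_iff₀' M.g_pos).1 hα.1
  rw [← hw.reportCutoff_eq_C₂ hα' hg]
  exact ⟨M.excessInv_pos (sub_pos.2 hval), hw.reportCutoff_lt_cbar hα',
    cutoffMechanism_of_safe_le _ hg⟩

lemma non_bonus (hw : M.IsBellmanSolution w) (hα : M.s / M.g ≤ α)
    (hval : M.r * w α = M.myopic α) {c : ℝ} (hc : 0 ≤ c) :
    hw.mechanism.p α c = 1 ∧ hw.mechanism.q α c = 0 := by
  have hC : M.reportCutoff w α = 0 := M.excessInv_of_nonpos (sub_nonpos.2 hval.le)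
  have h := cutoffMechanism_of_safe_le hw.measurable_reportCutoff
    ((div_le_iff₀' M.g_pos).1 hα) c
  rwa [hC, if_neg hc.not_gt] at h

end IsBellmanSolution

end Market

end

theorem mainTheorem3 (M : Market) :
    ∃ (m : M.Mechanism) (aSAPC aPCFC aFCNB : ℝ),
      m.IncentiveCompatible ∧ m.IsOptimal ∧
      -- the value function is differentiable and solves the planner's differential equation
      (∀ α ∈ Set.Ioo (0 : ℝ) 1, DifferentiableAt ℝ M.W α ∧
        (M.r + M.lam * α * m.reportProb α) * M.W α =
          M.lam * α * M.z * M.expect (m.p α) + (1 - M.expect (m.p α)) * M.s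
            - M.expect (fun c => m.p α c * m.q α c * c)
            + M.lam ^ 2 * M.z * α / M.r * m.reportProb α
            + (α ^ 2 - α) * M.lam * deriv M.W α * m.reportProb α) ∧
      0 < aSAPC ∧ aSAPC < aPCFC ∧ aPCFC < aFCNB ∧ aFCNB < 1 ∧
      -- Safe Arm
      (∀ α ∈ Set.Ioo 0 aSAPC, ∀ c ∈ Set.Icc 0 M.cbar, m.p α c = 0 ∧ m.q α c = 0) ∧
      -- Partial Coverage
      (∀ α ∈ Set.Ioo aSAPC aPCFC, 0 < M.C₁ α ∧ M.C₁ α < M.cbar ∧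
        ∀ c ∈ Set.Icc 0 M.cbar, m.q α c = 1 ∧ m.p α c = if c < M.C₁ α then 1 else 0) ∧
      -- Full Coverage
      (∀ α ∈ Set.Ioo aPCFC aFCNB, 0 < M.C₂ α ∧ M.C₂ α < M.cbar ∧
        ∀ c ∈ Set.Icc 0 M.cbar, m.p α c = 1 ∧ m.q α c = if c < M.C₂ α then 1 else 0) ∧
      -- Non Bonus
      (∀ α ∈ Set.Ioo aFCNB 1, ∀ c ∈ Set.Icc 0 M.cbar, m.p α c = 1 ∧ m.q α c = 0) := by
  obtain ⟨w, hw⟩ := M.exists_isBellmanSolution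
  obtain ⟨a₁, ha₁, hvalue, hmyopic⟩ := hw.exists_riskyCutoff
  have hsafe := M.safeCutoff_lt
  refine ⟨hw.mechanism, M.safeCutoff, M.s / M.g, a₁,
    Market.incentiveCompatible_cutoffMechanism _, hw.isOptimal_mechanism,
    fun α hα => ⟨(hw.hasDerivAt_W hα).differentiableAt, ?_⟩,
    M.safeCutoff_pos, hsafe, ha₁.1, ha₁.2,
    fun α hα c hc => hw.safe_arm (Ioo_subset_Ioc_self hα) hc.1,
    fun α hα => ?_, fun α hα => ?_,
    fun α hα c hc => hw.non_bonus (ha₁.1.trans hα.1).le (hmyopic α ⟨hα.1.le, hα.2⟩) hc.1⟩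
  · have hbellman := hw.mul_W_eq hα
    rw [hw.mechanism.flowSurplus_eq hα, Market.B, Market.g] at hbellman
    linear_combination hbellman
  · obtain ⟨hpos, hlt, hpq⟩ := hw.partial_coverage hα (hvalue α ⟨hα.1, hα.2.trans ha₁.1⟩)
    exact ⟨hpos, hlt, fun c _ => hpq c⟩
  · obtain ⟨hpos, hlt, hpq⟩ := hw.full_coverage ⟨hα.1.le, hα.2.trans ha₁.2⟩
      (hvalue α ⟨hsafe.trans hα.1, hα.2⟩)
    exact ⟨hpos, hlt, fun c _ => hpq c⟩
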